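/- Let $n\ge 1$ be an integer, $\kappa>0$, $\ell\in\mathbb Z$ and $\delta\in\mathbb Z_{\ge 0}$. For $z\in\mathbb C^{n+1}\setminus\{0\}$ put $s=\sum_i|z_i|^2$ and $$F(s)=\Bigl(1+\frac{\kappa}{s^{n+1}}\Bigr)^{\frac1{n+1}},\qquad g=F\,|dz|^2+F'\,|\bar z\,dz|^2,\quad\text{i.e. } g_{\mu\bar\nu}=F\delta_{\mu\nu}+F'\,\bar z_\mu z_\nu .$$ The quotient of $\mathbb C^{n+1}\setminus\{0\}$ by multiplication with $(n+1)$-th roots of unity is the complement of the zero section of $\mathcal O(-n-1)\to\mathbb{CP}^n$, and $g$ descends to it (it is the Calabi Ricci-flat Kähler metric, and the zero section is a null set). Let $$\mathcal A=\ell(A-\bar A),\qquad A=\kappa^{\frac n{n+1}}\,\frac{z\,d\bar z}{2s^{n+1}F^n},$$ and let $D_{\mathcal A}=\bar\partial-\bar\partial^*+\mathcal A\,\cdot$ be the Dirac operator of the canonical spin-$c$ structure twisted by $\mathcal A$, where a 1-form $\upsilon$ acts on a $(0,1)$-form $\sigma$ by $\upsilon\cdot\sigma=\upsilon^{0,1}\wedge\sigma+\sum_{\mu,\nu}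 g^{\mu\bar\nu}\upsilon_\mu\sigma_{\bar\nu}\in\Lambda^{0,2}\oplus\Lambda^0$. There exist positive functions $f$ on $(0,\infty)$ with $(\log f)'=\dfrac{\ell\,\kappa^{n/(n+1)}}{2F^ns^{n+1}}$. For every such $f$ and every homogeneous polynomial $P\in\mathbb C[z_1,\dots,z_{n+1}]$ of degree $\delta$, the $(0,1)$-form $$\sigma=P(z)\,h_0(s)\,f(s)\,\bar\partial s,\qquad h_0=\frac1{F^ns^{\delta+n+1}},$$ is smooth on $\mathbb C^{n+1}\setminus\{0\}$ and satisfies $D_{\mathcal A}\sigma=0$ there. Its pointwise norm $|\sigma|_g^2$ is invariant under multiplication of $z$ by $(n+1)$-th roots of unity, and, if $P\ne0$, $$\int_{\mathcal O(-n-1)}|\sigma|_g^2\,d\mathrm{vol}_g<\infty\iff \ell>\delta .$$ -/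

import Mathlib

open MeasureTheory
open scoped ENNReal ContDiff ComplexConjugate

namespace CalabiDirac

noncomputable section

/-! ### Dolbeault calculus on open subsets of `ℂᵐ` with a Hermitian metric

A Hermitian metric is given by the matrix `G z μ ν = g_{μ ν̄}(z)`, so that
`g = Re ∑ g_{μ ν̄} dz_μ dz̄_ν`. A `(0,1)`-form `∑ σ_ν dz̄_ν` is given by its coefficients `σ z ν`,
a `(0,2)`-form `∑_{μ<ν} τ_{μν} dz̄_μ ∧ dz̄_ν` by its antisymmetric coefficients. -/

/-- The Wirtinger derivative `∂u/∂z_μ = ½ (∂u/∂x_μ - i ∂u/∂y_μ)`. -/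
def dz {m : ℕ} (μ : Fin m) (u : (Fin m → ℂ) → ℂ) (z : Fin m → ℂ) : ℂ :=
  (fderiv ℝ u z (Pi.single μ 1) - Complex.I * fderiv ℝ u z (Pi.single μ Complex.I)) / 2

/-- The Wirtinger derivative `∂u/∂z̄_μ = ½ (∂u/∂x_μ + i ∂u/∂y_μ)`. -/
def dzbar {m : ℕ} (μ : Fin m) (u : (Fin m → ℂ) → ℂ) (z : Fin m → ℂ) : ℂ :=
  (fderiv ℝ u z (Pi.single μ 1) + Complex.I * fderiv ℝ u z (Pi.single μ Complex.I)) / 2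

/-- Coefficients of the `(0,1)`-form `∂̄u` of a function `u`. -/
def dbarFun {m : ℕ} (u : (Fin m → ℂ) → ℂ) (z : Fin m → ℂ) : Fin m → ℂ :=
  fun ν => dzbar ν u z

/-- Coefficients of the `(0,2)`-form `∂̄σ` of a `(0,1)`-form `σ`. -/
def dbarForm {m : ℕ} (σ : (Fin m → ℂ) → Fin m → ℂ) (z : Fin m → ℂ) : Fin m → Fin m → ℂ :=
  fun μ ν => dzbar μ (fun w => σ w ν) z - dzbar ν (fun w => σ w μ) z

/-- The inverse metric `g^{μ ν̄}`, characterised by `∑_ν g_{ρ ν̄} g^{μ ν̄} = δ_ρ^μ`. -/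
def invMetric {m : ℕ} (G : (Fin m → ℂ) → Matrix (Fin m) (Fin m) ℂ) (z : Fin m → ℂ)
    (μ ν : Fin m) : ℂ :=
  (G z)⁻¹ ν μ

/-- The Hermitian inner product of `(0,1)`-forms, `⟨α, β⟩ = ∑ g^{ν μ̄} α_μ (β_ν)‾`. -/
def formInner {m : ℕ} (G : (Fin m → ℂ) → Matrix (Fin m) (Fin m) ℂ)
    (α β : (Fin m → ℂ) → Fin m → ℂ) (z : Fin m → ℂ) : ℂ :=
  ∑ μ, ∑ ν, invMetric G z ν μ * α z μ * conj (β z ν)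

/-- The squared pointwise norm `|σ|²` of a `(0,1)`-form. -/
def formNormSq {m : ℕ} (G : (Fin m → ℂ) → Matrix (Fin m) (Fin m) ℂ)
    (σ : (Fin m → ℂ) → Fin m → ℂ) (z : Fin m → ℂ) : ℝ :=
  (formInner G σ σ z).re

/-- The Riemannian volume measure of `g`. The real `2m × 2m` matrix of `g` has determinant
`(det g_{μ ν̄})²`, so the volume density is `det g_{μ ν̄}`. -/
def metricVolume {m : ℕ} (G : (Fin m → ℂ) → Matrix (Fin m) (Fin m) ℂ) :
    Measure (Fin m → ℂ) :=
  volume.withDensity (fun z => ENNReal.ofReal (G z).det.re)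

/-- `∂̄*` on `(0,1)`-forms, for an arbitrary Hermitian metric:
`∂̄*σ = - (det g)⁻¹ ∑_{μ,ν} ∂_μ (det g · g^{μ ν̄} σ_ν)`.
It is the formal `L²`-adjoint of `∂̄` on functions by `integral_dbarFun_eq_dbarStar`. -/
def dbarStar {m : ℕ} (G : (Fin m → ℂ) → Matrix (Fin m) (Fin m) ℂ)
    (σ : (Fin m → ℂ) → Fin m → ℂ) (z : Fin m → ℂ) : ℂ :=
  -((G z).det)⁻¹ *
    ∑ μ, ∑ ν, dz μ (fun w => (G w).det * invMetric G w μ ν * σ w ν) z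

lemma conj_dz {m : ℕ} (μ : Fin m) (u : (Fin m → ℂ) → ℂ) (z : Fin m → ℂ) :
    conj (dz μ u z) = dzbar μ (fun w => conj (u w)) z := by
  have h : fderiv ℝ (fun w => conj (u w)) z
      = (Complex.conjCLE : ℂ →L[ℝ] ℂ).comp (fderiv ℝ u z) :=
    Complex.conjCLE.comp_fderiv (f := u) (x := z)
  simp [dz, dzbar, h, Complex.conj_ofNat]

lemma integral_dzbar_mul {m : ℕ} (U : Set (Fin m → ℂ)) (hU : IsOpen U) (μ : Fin m)
    (φ u : (Fin m → ℂ) → ℂ) (hφ : ContDiff ℝ ∞ φ) (hc : HasCompactSupport φ)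
    (hs : tsupport φ ⊆ U) (hu : ContDiffOn ℝ 1 u U) :
    Integrable (fun z => dzbar μ φ z * u z) ∧ Integrable (fun z => φ z * dzbar μ u z) ∧
    ∫ z, dzbar μ φ z * u z = - ∫ z, φ z * dzbar μ u z := by
  have key : ∀ (a b : (Fin m → ℂ) → ℂ), Continuous a → tsupport a ⊆ tsupport φ →
      ContinuousOn b U → Integrable (fun z => a z * b z) := by
    intro a b ha hat hb
    have hcont : Continuous (fun z => a z * b z) := by
      rw [continuous_iff_continuousAt]
      intro z
      by_cases hz : z ∈ tsupport a
      · exact ha.continuousAt.mul (hb.continuousAt (hU.mem_nhds (hs (hat hz))))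
      · have : (fun z => a z * b z) =ᶠ[nhds z] fun _ => 0 := by
          filter_upwards [(isClosed_tsupport a).isOpen_compl.mem_nhds hz] with w hw
          simp [image_eq_zero_of_notMem_tsupport hw]
        exact continuousAt_const.congr this.symm
    apply hcont.integrable_of_hasCompactSupport
    apply HasCompactSupport.mul_right
    exact hc.mono' ((subset_tsupport a).trans hat)
  have hd : ∀ v, Continuous (fun z => fderiv ℝ φ z v) := fun v =>
    (hφ.continuous_fderiv (by simp)).clm_apply continuous_const
  have hdt : ∀ v, tsupport (fun z => fderiv ℝ φ z v) ⊆ tsupport φ := fun v =>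
    closure_minimal (fun z hz => support_fderiv_subset ℝ (f := φ)
      (by intro h; apply hz; simp [h])) (isClosed_tsupport φ)
  have hud : ∀ v, ContinuousOn (fun z => fderiv ℝ u z v) U := fun v =>
    (hu.continuousOn_fderiv_of_isOpen hU le_rfl).clm_apply continuousOn_const
  have I1 := fun v => key _ u (hd v) (hdt v) hu.continuousOn
  have I2 := fun v => key φ _ hφ.continuous subset_rfl (hud v)
  have I3 := key φ u hφ.continuous subset_rfl hu.continuousOn
  have ibp : ∀ v, ∫ z, φ z * fderiv ℝ u z v = - ∫ z, fderiv ℝ φ z v * u z := fun v =>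
    integral_mul_fderiv_eq_neg_fderiv_mul_of_integrable (I1 v) (I2 v) I3
      (fun x _ => (hφ.differentiable (by simp)) x)
      (fun x hx => (hu.differentiableOn one_ne_zero).differentiableAt (hU.mem_nhds (hs hx)))
  have e1 : (fun z => dzbar μ φ z * u z) = fun z =>
      (1 / 2 : ℂ) * (fderiv ℝ φ z (Pi.single μ 1) * u z)
        + (Complex.I / 2) * (fderiv ℝ φ z (Pi.single μ Complex.I) * u z) := by
    funext z; simp only [dzbar]; ring
  have e2 : (fun z => φ z * dzbar μ u z) = fun z =>
      (1 / 2 : ℂ) * (φ z * fderiv ℝ u z (Pi.single μ 1))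
        + (Complex.I / 2) * (φ z * fderiv ℝ u z (Pi.single μ Complex.I)) := by
    funext z; simp only [dzbar]; ring
  rw [e1, e2]
  refine ⟨((I1 _).const_mul _).add ((I1 _).const_mul _),
    ((I2 _).const_mul _).add ((I2 _).const_mul _), ?_⟩
  rw [integral_add ((I1 _).const_mul _) ((I1 _).const_mul _),
    integral_add ((I2 _).const_mul _) ((I2 _).const_mul _)]
  simp only [integral_const_mul, ibp]
  ring

/-- `dbarStar` is the formal `L²`-adjoint of `∂̄`: on an open set `U`,
`∫ ⟨∂̄φ, σ⟩ det g = ∫ φ (∂̄*σ)‾ det g` for every test function `φ` with compact support in `U`. -/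
theorem integral_dbarFun_eq_dbarStar {m : ℕ} (U : Set (Fin m → ℂ)) (hU : IsOpen U)
    (G : (Fin m → ℂ) → Matrix (Fin m) (Fin m) ℂ) (σ : (Fin m → ℂ) → Fin m → ℂ)
    (hG : ∀ z ∈ U, (G z).IsHermitian) (hdet : ∀ z ∈ U, (G z).det ≠ 0)
    (hσ : ∀ μ ν, ContDiffOn ℝ 1 (fun w => (G w).det * invMetric G w μ ν * σ w ν) U)
    (φ : (Fin m → ℂ) → ℂ) (hφ : ContDiff ℝ ∞ φ) (hc : HasCompactSupport φ)
    (hs : tsupport φ ⊆ U) :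
    ∫ z, formInner G (dbarFun φ) σ z * (G z).det
      = ∫ z, φ z * conj (dbarStar G σ z) * (G z).det := by
  have hφ0 : ∀ z, z ∉ U → φ z = 0 := fun z hz =>
    image_eq_zero_of_notMem_tsupport (fun h => hz (hs h))
  have hdφ0 : ∀ z, z ∉ U → ∀ μ, dzbar μ φ z = 0 := by
    intro z hz μ
    have : fderiv ℝ φ z = 0 := by
      by_contra h
      exact hz (hs (support_fderiv_subset ℝ (f := φ) h))
    simp [dzbar, this]
  have hdc : ∀ z ∈ U, conj (G z).det = (G z).det := by
    intro z hz
    have := Matrix.det_conjTranspose (G z)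
    rw [(hG z hz).eq] at this
    exact this.symm
  have hic : ∀ z ∈ U, ∀ μ ν, conj (invMetric G z μ ν) = invMetric G z ν μ := by
    intro z hz μ ν
    exact (hG z hz).inv.apply μ ν
  have L : (fun z => formInner G (dbarFun φ) σ z * (G z).det) = fun z => ∑ μ, ∑ ν,
      dzbar μ φ z * conj ((G z).det * invMetric G z μ ν * σ z ν) := by
    funext z
    by_cases hz : z ∈ U
    · simp only [formInner, dbarFun, Finset.sum_mul, map_mul, hdc z hz, hic z hz]
      refine Finset.sum_congr rfl fun μ _ => Finset.sum_congr rfl fun ν _ => by ring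
    · simp [formInner, dbarFun, hdφ0 z hz]
  have R : (fun z => φ z * conj (dbarStar G σ z) * (G z).det) = fun z => ∑ μ, ∑ ν,
      -(φ z * dzbar μ (fun w => conj ((G w).det * invMetric G w μ ν * σ w ν)) z) := by
    funext z
    by_cases hz : z ∈ U
    · have h0 := hdet z hz
      simp only [dbarStar, map_mul (starRingEnd ℂ), map_neg, map_inv₀, hdc z hz, map_sum,
        conj_dz, Finset.sum_neg_distrib, ← Finset.mul_sum]
      field_simp
    · simp [hφ0 z hz]
  have B := fun μ ν => integral_dzbar_mul U hU μ φ
    (fun w => conj ((G w).det * invMetric G w μ ν * σ w ν)) hφ hc hs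
    (Complex.conjCLE.contDiff.comp_contDiffOn (hσ μ ν))
  have B1 : ∀ μ ν, Integrable (fun z =>
      -(φ z * dzbar μ (fun w => conj ((G w).det * invMetric G w μ ν * σ w ν)) z)) :=
    fun μ ν => (B μ ν).2.1.neg
  rw [L, R, integral_finsetSum _ fun μ _ => integrable_finsetSum _ fun ν _ => (B μ ν).1,
    integral_finsetSum _ fun μ _ => integrable_finsetSum _ fun ν _ => B1 μ ν]
  refine Finset.sum_congr rfl fun μ _ => ?_
  rw [integral_finsetSum _ fun ν _ => (B μ ν).1, integral_finsetSum _ fun ν _ => B1 μ ν]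
  refine Finset.sum_congr rfl fun ν _ => ?_
  rw [integral_neg]
  exact (B μ ν).2.2

/-- A complex `1`-form `∑ υ_μ dz_μ + ∑ υ_μ̄ dz̄_μ`, given by its two types of coefficients. -/
structure OneForm (m : ℕ) where
  /-- coefficients of the `(1,0)`-part -/
  holo : (Fin m → ℂ) → Fin m → ℂ
  /-- coefficients of the `(0,1)`-part -/
  anti : (Fin m → ℂ) → Fin m → ℂ

/-- The Dirac operator `D = ∂̄ - ∂̄*` of the canonical spin-c structure on `Λ^{0,1}`; its values
are the components in `Λ^0 ⊕ Λ^{0,2}`. -/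
def dirac {m : ℕ} (G : (Fin m → ℂ) → Matrix (Fin m) (Fin m) ℂ)
    (σ : (Fin m → ℂ) → Fin m → ℂ) (z : Fin m → ℂ) : ℂ × (Fin m → Fin m → ℂ) :=
  (-dbarStar G σ z, dbarForm σ z)

/-- The Clifford action `υ · σ = υ^{0,1} ∧ σ + ι_{υ♯} σ` on `σ ∈ Λ^{0,1}`, with components in
`Λ^0 ⊕ Λ^{0,2}`; here `ι_{υ♯} σ = ∑ g^{μ ν̄} υ_μ σ_ν` only involves the `(1,0)`-part of `υ`. -/
def clifford {m : ℕ} (G : (Fin m → ℂ) → Matrix (Fin m) (Fin m) ℂ) (υ : OneForm m)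
    (σ : (Fin m → ℂ) → Fin m → ℂ) (z : Fin m → ℂ) : ℂ × (Fin m → Fin m → ℂ) :=
  (∑ μ, ∑ ν, invMetric G z μ ν * υ.holo z μ * σ z ν,
    fun μ ν => υ.anti z μ * σ z ν - υ.anti z ν * σ z μ)

/-- The twisted Dirac operator `D_𝒜 = D + 𝒜` on `Λ^{0,1}`. -/
def twistedDirac {m : ℕ} (G : (Fin m → ℂ) → Matrix (Fin m) (Fin m) ℂ) (𝒜 : OneForm m)
    (σ : (Fin m → ℂ) → Fin m → ℂ) (z : Fin m → ℂ) : ℂ × (Fin m → Fin m → ℂ) :=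
  dirac G σ z + clifford G 𝒜 σ z

/-- `σ` is a smooth `(0,1)`-form on `U` with `D_𝒜 σ = 0`. -/
def IsZeroMode {m : ℕ} (G : (Fin m → ℂ) → Matrix (Fin m) (Fin m) ℂ) (𝒜 : OneForm m)
    (U : Set (Fin m → ℂ)) (σ : (Fin m → ℂ) → Fin m → ℂ) : Prop :=
  ContDiffOn ℝ ∞ σ U ∧ ∀ z ∈ U, twistedDirac G 𝒜 σ z = 0

/-! ### The Calabi metric on `O(-n-1) → ℂPⁿ` -/

/-- `s = |z_1|² + ⋯ + |z_{n+1}|²`. -/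
def sq {n : ℕ} (z : Fin (n + 1) → ℂ) : ℝ := ∑ i, ‖z i‖ ^ 2

/-- `F(s) = (1 + κ / s^{n+1})^{1/(n+1)}`. -/
def calabiF (n : ℕ) (κ s : ℝ) : ℝ := (1 + κ / s ^ (n + 1)) ^ (1 / ((n : ℝ) + 1))

/-- The Calabi metric `g = F |dz|² + F' |z̄ dz|²`, that is `g_{μ ν̄} = F δ_{μν} + F' z̄_μ z_ν`. -/
def calabiMetric (n : ℕ) (κ : ℝ) (z : Fin (n + 1) → ℂ) :
    Matrix (Fin (n + 1)) (Fin (n + 1)) ℂ :=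
  Matrix.of fun μ ν =>
    (calabiF n κ (sq z) : ℂ) * (if μ = ν then 1 else 0)
      + ((deriv (calabiF n κ) (sq z) : ℝ) : ℂ) * (conj (z μ) * z ν)

/-- The `(0,1)`-form `A = κ^{n/(n+1)} z dz̄ / (2 s^{n+1} Fⁿ)`. -/
def connA (n : ℕ) (κ : ℝ) (z : Fin (n + 1) → ℂ) : Fin (n + 1) → ℂ :=
  fun ν => ((κ ^ ((n : ℝ) / ((n : ℝ) + 1)) /
    (2 * sq z ^ (n + 1) * calabiF n κ (sq z) ^ n) : ℝ) : ℂ) * z ν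

/-- The connection `𝒜 = ℓ (A - Ā)`. -/
def calabiConnection (n : ℕ) (κ : ℝ) (ℓ : ℤ) : OneForm (n + 1) where
  holo z μ := -(ℓ : ℂ) * conj (connA n κ z μ)
  anti z μ := (ℓ : ℂ) * connA n κ z μ

/-- The complement of the zero section of `O(-n-1)`: the quotient of `ℂ^{n+1} ∖ {0}` by the
multiplication with `(n+1)`-th roots of unity, the class of `z` being the vector `z^{⊗(n+1)}` of
the `(n+1)`-st power of the tautological line through `z`. -/
def rootSetoid (n : ℕ) : Setoid {z : Fin (n + 1) → ℂ // z ≠ 0} where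
  r z w := ∃ ε : ℂ, ε ^ (n + 1) = 1 ∧ w.1 = ε • z.1
  iseqv :=
    { refl := fun z => ⟨1, by simp⟩
      symm := by
        rintro z w ⟨ε, hε, h⟩
        have h0 : ε ≠ 0 := by rintro rfl; simp at hε
        exact ⟨ε⁻¹, by simp [hε], by rw [h, smul_smul, inv_mul_cancel₀ h0, one_smul]⟩
      trans := by
        rintro z w v ⟨ε, hε, h⟩ ⟨η, hη, h'⟩
        exact ⟨η * ε, by rw [mul_pow, hε, hη, one_mul], by rw [h', h, smul_smul]⟩ }

/-- The complement of the zero section in the total space of `O(-n-1)`, see `rootSetoid`. -/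
abbrev LineBundleCompl (n : ℕ) : Type := Quotient (rootSetoid n)

/-- The Calabi metric is invariant under multiplication by `(n+1)`-th roots of unity, hence
descends to `LineBundleCompl n`. -/
lemma calabiMetric_smul (n : ℕ) (κ : ℝ) (z : Fin (n + 1) → ℂ) (ε : ℂ) (hε : ε ^ (n + 1) = 1) :
    calabiMetric n κ (ε • z) = calabiMetric n κ z := by
  have h1 : ‖ε‖ = 1 := Complex.norm_eq_one_of_pow_eq_one hε n.succ_ne_zero
  have h2 : sq (ε • z) = sq z := by simp [sq, h1]
  have h3 : conj ε * ε = 1 := by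
    rw [mul_comm, Complex.mul_conj, Complex.normSq_eq_norm_sq, h1]; simp
  ext μ ν
  have h4 : conj ((ε • z) μ) * (ε • z) ν = conj (z μ) * z ν := by
    simp only [Pi.smul_apply, smul_eq_mul, map_mul]
    linear_combination (conj (z μ) * z ν) * h3
  simp only [calabiMetric, Matrix.of_apply, h2, h4]

/-- The Riemannian volume of the Calabi metric on the complement of the zero section of `O(-n-1)`
(the zero section is a null set). The quotient map `ℂ^{n+1} ∖ {0} → LineBundleCompl n` is a local
isometry with `n + 1` sheets, whence the factor `1/(n+1)`. -/
def calabiVolume (n : ℕ) (κ : ℝ) : Measure (LineBundleCompl n) :=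
  ((n : ℝ≥0∞) + 1)⁻¹ •
    ((metricVolume (calabiMetric n κ)).comap Subtype.val).map (Quotient.mk (rootSetoid n))

/-! ### The zero modes -/

/-- `f` is a positive function on `(0, ∞)` with
`(log f)' = ℓ κ^{n/(n+1)} / (2 Fⁿ s^{n+1})`. -/
def IsTwistFactor (n : ℕ) (κ : ℝ) (ℓ : ℤ) (f : ℝ → ℝ) : Prop :=
  ∀ s : ℝ, 0 < s → 0 < f s ∧
    HasDerivAt (fun t => Real.log (f t))
      ((ℓ : ℝ) * κ ^ ((n : ℝ) / ((n : ℝ) + 1)) / (2 * calabiF n κ s ^ n * s ^ (n + 1))) s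

/-- `h₀ = 1 / (Fⁿ s^{δ+n+1})`. -/
def hZero (n : ℕ) (κ : ℝ) (δ : ℕ) (s : ℝ) : ℝ := 1 / (calabiF n κ s ^ n * s ^ (δ + n + 1))

/-- The `(0,1)`-form `σ = P(z) h₀(s) f(s) ∂̄s`. -/
def zeroMode (n : ℕ) (κ : ℝ) (δ : ℕ) (f : ℝ → ℝ) (P : MvPolynomial (Fin (n + 1)) ℂ)
    (z : Fin (n + 1) → ℂ) : Fin (n + 1) → ℂ :=
  fun ν => MvPolynomial.eval z P * (hZero n κ δ (sq z) : ℂ) * (f (sq z) : ℂ)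
    * dbarFun (fun w => ((sq w : ℝ) : ℂ)) z ν

end

end CalabiDirac

open CalabiDirac

namespace CalabiDirac

noncomputable section

/-! ### Wirtinger calculus -/

section Wirtinger

variable {m : ℕ} {μ : Fin m} {u v : (Fin m → ℂ) → ℂ} {z : Fin m → ℂ}

/-! Everything rests on (sF)^(n+1) = s^(n+1) + κ. Differentiating gives F + sF' = F⁻ⁿ, which has two
consequences: det g = 1 (`det_calabiMetric`), so ∂̄* is minus a flat divergence after raising the
index, and z is an eigenvector of the inverse metric with eigenvalue Fⁿ (`sum_calabiInv_mul`).

Zero mode equation. The Λ^{0,2} part vanishes because P is holomorphic and ∂̄σ and 𝒜^{0,1} ∧ σ are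
both multiples of ∂̄s ∧ ∂̄s. For the Λ^0 part, raising the index of σ gives the vector P ψ z_μ with
ψ = f / s^(δ+n+1). By Euler's identity its divergence is P ((n+1+δ) ψ + s ψ'). The power of s in ψ
cancels the first term and leaves P f s^(-(δ+n)) (log f)', which the contraction with -ℓ Ā cancels
(`dbarStar_zeroMode`, `clifford_zeroMode_fst`).

Integrability. Polar coordinates split ∫|σ|² into the integral of |P|² over the sphere, finite and
non-zero for P ≠ 0, and the integral over r > 0 of f(r²)² / ((r²F)ⁿ r^(2δ+1))
(`setLIntegral_formNormSq_zeroMode`). At infinity f is bounded and sF ≥ s, so there is always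
convergence. At 0, sF tends to κ^(1/(n+1)) and s (log f)' to ℓ/2. The integrand is then comparable
with r^(2ℓ-2δ-1), integrable exactly when ℓ > δ (`integrableOn_radialProfile_iff`). -/

lemma dz_congr (h : u =ᶠ[nhds z] v) : dz μ u z = dz μ v z := by
  simp only [dz, h.fderiv_eq]

lemma dz_add (hu : DifferentiableAt ℝ u z) (hv : DifferentiableAt ℝ v z) :
    dz μ (fun w => u w + v w) z = dz μ u z + dz μ v z := by
  simp only [dz, fderiv_fun_add hu hv, add_apply]
  ring

lemma dzbar_add (hu : DifferentiableAt ℝ u z) (hv : DifferentiableAt ℝ v z) :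
    dzbar μ (fun w => u w + v w) z = dzbar μ u z + dzbar μ v z := by
  simp only [dzbar, fderiv_fun_add hu hv, add_apply]
  ring

lemma dz_mul (hu : DifferentiableAt ℝ u z) (hv : DifferentiableAt ℝ v z) :
    dz μ (fun w => u w * v w) z = dz μ u z * v z + u z * dz μ v z := by
  simp only [dz, fderiv_fun_mul hu hv, add_apply,
    smul_apply, smul_eq_mul]
  ring

lemma dzbar_mul (hu : DifferentiableAt ℝ u z) (hv : DifferentiableAt ℝ v z) :
    dzbar μ (fun w => u w * v w) z = dzbar μ u z * v z + u z * dzbar μ v z := by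
  simp only [dzbar, fderiv_fun_mul hu hv, add_apply,
    smul_apply, smul_eq_mul]
  ring

lemma dz_sum {ι : Type*} (t : Finset ι) (u : ι → (Fin m → ℂ) → ℂ)
    (hu : ∀ i ∈ t, DifferentiableAt ℝ (u i) z) :
    dz μ (fun w => ∑ i ∈ t, u i w) z = ∑ i ∈ t, dz μ (u i) z := by
  simp only [dz, fderiv_fun_sum hu, sum_apply, Finset.mul_sum,
    ← Finset.sum_sub_distrib, Finset.sum_div]

lemma fderiv_coord (ν : Fin m) (z h : Fin m → ℂ) :
    fderiv ℝ (fun w : Fin m → ℂ => w ν) z h = h ν := by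
  have : HasFDerivAt (fun w : Fin m → ℂ => w ν)
      (ContinuousLinearMap.proj (R := ℝ) (φ := fun _ : Fin m => ℂ) ν) z :=
    (ContinuousLinearMap.proj (R := ℝ) (φ := fun _ : Fin m => ℂ) ν).hasFDerivAt
  rw [this.fderiv]; rfl

lemma dz_coord (μ ν : Fin m) (z : Fin m → ℂ) :
    dz μ (fun w => w ν) z = if μ = ν then 1 else 0 := by
  simp only [dz, fderiv_coord, Pi.single_apply, eq_comm (a := ν)]
  split_ifs <;> simp

lemma dzbar_coord (μ ν : Fin m) (z : Fin m → ℂ) : dzbar μ (fun w => w ν) z = 0 := by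
  simp only [dzbar, fderiv_coord, Pi.single_apply, eq_comm (a := ν)]
  split_ifs <;> simp

lemma differentiable_eval (P : MvPolynomial (Fin m) ℂ) :
    Differentiable ℝ (fun w : Fin m → ℂ => MvPolynomial.eval w P) := by
  induction P using MvPolynomial.induction_on with
  | C a => simp
  | add p q hp hq => simpa using hp.fun_add hq
  | mul_X p i hp => simpa using hp.fun_mul (differentiable_apply i)

lemma contDiff_eval (P : MvPolynomial (Fin m) ℂ) :
    ContDiff ℝ ∞ (fun w : Fin m → ℂ => MvPolynomial.eval w P) := by
  induction P using MvPolynomial.induction_on with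
  | C a => simpa using contDiff_const
  | add p q hp hq => simpa using hp.add hq
  | mul_X p i hp => simpa using hp.mul (contDiff_apply ℝ ℂ i)

lemma dz_eval (P : MvPolynomial (Fin m) ℂ) (μ : Fin m) (z : Fin m → ℂ) :
    dz μ (fun w => MvPolynomial.eval w P) z = MvPolynomial.eval z (MvPolynomial.pderiv μ P) := by
  induction P using MvPolynomial.induction_on with
  | C a => simp [dz]
  | add p q hp hq =>
    simp only [map_add]
    rw [dz_add (differentiable_eval p z) (differentiable_eval q z), hp, hq]
  | mul_X p i hp =>
    simp only [map_mul, MvPolynomial.eval_X]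
    rw [dz_mul (differentiable_eval p z) (differentiable_apply i z), hp, dz_coord]
    simp only [MvPolynomial.pderiv_mul, MvPolynomial.pderiv_X, map_add, map_mul,
      MvPolynomial.eval_X, Pi.single_apply, eq_comm (a := i)]
    split_ifs <;> simp

lemma dzbar_eval (P : MvPolynomial (Fin m) ℂ) (μ : Fin m) (z : Fin m → ℂ) :
    dzbar μ (fun w => MvPolynomial.eval w P) z = 0 := by
  induction P using MvPolynomial.induction_on with
  | C a => simp [dzbar]
  | add p q hp hq =>
    simp only [map_add]
    rw [dzbar_add (differentiable_eval p z) (differentiable_eval q z), hp, hq, add_zero]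
  | mul_X p i hp =>
    simp only [map_mul, MvPolynomial.eval_X]
    rw [dzbar_mul (differentiable_eval p z) (differentiable_apply i z), hp, dzbar_coord]
    simp

end Wirtinger

/-! ### Wirtinger derivatives of functions of s -/

section Radial

variable {n : ℕ}

lemma sq_pos {z : Fin (n + 1) → ℂ} (hz : z ≠ 0) : 0 < sq z := by
  obtain ⟨i, hi⟩ := Function.ne_iff.mp hz
  exact Finset.sum_pos' (fun j _ => by positivity)
    ⟨i, Finset.mem_univ i, pow_pos (norm_pos_iff.mpr hi) 2⟩

lemma sum_conj_mul (z : Fin (n + 1) → ℂ) : ∑ i, conj (z i) * z i = (sq z : ℂ) := by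
  simp [sq, Complex.conj_mul']

lemma contDiff_sq : ContDiff ℝ ∞ (sq : (Fin (n + 1) → ℂ) → ℝ) := by
  unfold sq
  exact ContDiff.sum fun i _ => (contDiff_norm_sq ℝ).comp (contDiff_apply ℝ ℂ i)

lemma fderiv_sq (z h : Fin (n + 1) → ℂ) :
    fderiv ℝ sq z h = ∑ i, 2 * ((z i).re * (h i).re + (z i).im * (h i).im) := by
  have key : ∀ i, HasFDerivAt (fun w : Fin (n + 1) → ℂ => ‖w i‖ ^ 2)
      (2 • (innerSL ℝ (z i)).comp
        (ContinuousLinearMap.proj (R := ℝ) (φ := fun _ : Fin (n + 1) => ℂ) i)) z := fun i =>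
    (ContinuousLinearMap.proj (R := ℝ) (φ := fun _ : Fin (n + 1) => ℂ) i).hasFDerivAt.norm_sq
  have : HasFDerivAt (sq : (Fin (n + 1) → ℂ) → ℝ) _ z := HasFDerivAt.fun_sum fun i _ => key i
  rw [this.fderiv]
  simp [Complex.inner, mul_comm, add_mul]

variable {φ : ℝ → ℝ} {φ' : ℝ} {z : Fin (n + 1) → ℂ}

lemma hasFDerivAt_radial (hφ : HasDerivAt φ φ' (sq z)) :
    HasFDerivAt (fun w => ((φ (sq w) : ℝ) : ℂ))
      (Complex.ofRealCLM.comp (φ' • fderiv ℝ sq z)) z :=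
  Complex.ofRealCLM.hasFDerivAt.comp z
    (hφ.comp_hasFDerivAt z (contDiff_sq.differentiable (by simp) z).hasFDerivAt)

lemma fderiv_sq_single (z : Fin (n + 1) → ℂ) (μ : Fin (n + 1)) (c : ℂ) :
    fderiv ℝ sq z (Pi.single μ c) = 2 * ((z μ).re * c.re + (z μ).im * c.im) := by
  rw [fderiv_sq, Finset.sum_eq_single μ]
  · simp
  · intro i _ hi; simp [Pi.single_eq_of_ne hi]
  · simp

lemma dz_radial (hφ : HasDerivAt φ φ' (sq z)) (μ : Fin (n + 1)) :
    dz μ (fun w => ((φ (sq w) : ℝ) : ℂ)) z = φ' * conj (z μ) := by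
  rw [dz, (hasFDerivAt_radial hφ).fderiv]
  simp only [ContinuousLinearMap.comp_apply, smul_apply, fderiv_sq_single]
  apply Complex.ext <;> simp <;> ring

lemma dzbar_radial (hφ : HasDerivAt φ φ' (sq z)) (μ : Fin (n + 1)) :
    dzbar μ (fun w => ((φ (sq w) : ℝ) : ℂ)) z = φ' * z μ := by
  rw [dzbar, (hasFDerivAt_radial hφ).fderiv]
  simp only [ContinuousLinearMap.comp_apply, smul_apply, fderiv_sq_single]
  apply Complex.ext <;> simp <;> ring

lemma dbarFun_sq (z : Fin (n + 1) → ℂ) : dbarFun (fun w => ((sq w : ℝ) : ℂ)) z = z := by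
  funext ν
  simpa [dbarFun] using dzbar_radial (φ := id) (hasDerivAt_id (sq z)) ν

end Radial

/-! ### The Calabi metric -/

section Metric

variable {n : ℕ} {κ s : ℝ}

lemma calabiF_base_pos (hκ : 0 < κ) (hs : 0 < s) : 0 < 1 + κ / s ^ (n + 1) := by positivity

lemma calabiF_pos (hκ : 0 < κ) (hs : 0 < s) : 0 < calabiF n κ s :=
  Real.rpow_pos_of_pos (calabiF_base_pos hκ hs) _

lemma calabiF_pow (hκ : 0 < κ) (hs : 0 < s) : calabiF n κ s ^ (n + 1) = 1 + κ / s ^ (n + 1) := by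
  rw [calabiF, ← Real.rpow_natCast, ← Real.rpow_mul (calabiF_base_pos hκ hs).le]
  have : 1 / ((n : ℝ) + 1) * ((n + 1 : ℕ) : ℝ) = 1 := by push_cast; field_simp
  rw [this, Real.rpow_one]

lemma hasDerivAt_calabiF (hκ : 0 < κ) (hs : 0 < s) :
    HasDerivAt (calabiF n κ) (-κ / (s ^ (n + 2) * calabiF n κ s ^ n)) s := by
  have hb := calabiF_base_pos (n := n) hκ hs
  have hF := calabiF_pos (n := n) hκ hs
  have hd : HasDerivAt (fun t : ℝ => 1 + κ / t ^ (n + 1)) (-(κ * (n + 1)) / s ^ (n + 2)) s := by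
    have h := (((hasDerivAt_pow (n + 1) s).fun_inv (by positivity)).const_mul κ).const_add 1
    simp only [← div_eq_mul_inv] at h
    refine h.congr_deriv ?_
    push_cast
    field_simp
    ring
  have h := hd.rpow_const (p := 1 / ((n : ℝ) + 1)) (Or.inl hb.ne')
  refine h.congr_deriv ?_
  have e : (1 + κ / s ^ (n + 1)) ^ (1 / ((n : ℝ) + 1)) = calabiF n κ s := rfl
  -- With b = F^(n+1) and p = 1/(n+1), b^(p-1) = F / F^(n+1) = F⁻ⁿ, so no real exponent survives.
  rw [Real.rpow_sub_one hb.ne', e, ← calabiF_pow hκ hs, pow_succ (calabiF n κ s)]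
  field_simp

lemma deriv_calabiF (hκ : 0 < κ) (hs : 0 < s) :
    deriv (calabiF n κ) s = -κ / (s ^ (n + 2) * calabiF n κ s ^ n) :=
  (hasDerivAt_calabiF hκ hs).deriv

/-- `F + s F' = F⁻ⁿ`. -/
lemma calabiF_pow_mul (hκ : 0 < κ) (hs : 0 < s) :
    calabiF n κ s ^ n * (calabiF n κ s + s * deriv (calabiF n κ) s) = 1 := by
  have hF := calabiF_pos (n := n) hκ hs
  have h := calabiF_pow (n := n) hκ hs
  rw [deriv_calabiF hκ hs]
  have : calabiF n κ s ^ n * (calabiF n κ s + s * (-κ / (s ^ (n + 2) * calabiF n κ s ^ n)))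
      = calabiF n κ s ^ (n + 1) - κ / s ^ (n + 1) := by
    field_simp
    ring
  rw [this, h]; ring

lemma contDiffOn_calabiF (hκ : 0 < κ) : ContDiffOn ℝ ∞ (calabiF n κ) (Set.Ioi 0) := by
  intro s (hs : 0 < s)
  apply ContDiffAt.contDiffWithinAt
  have hb : ContDiffAt ℝ ∞ (fun t : ℝ => 1 + κ / t ^ (n + 1)) s :=
    contDiffAt_const.add (contDiffAt_const.div (contDiffAt_id.pow _) (by simp; positivity))
  exact (Real.contDiffAt_rpow_const_of_ne (calabiF_base_pos (n := n) hκ hs).ne').comp s hb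

/-- The explicit inverse `g^{μ ν̄} = F⁻¹ (δ_{μν} - Fⁿ F' z_μ z̄_ν)` of the Calabi metric. -/
def calabiInv (n : ℕ) (κ : ℝ) (z : Fin (n + 1) → ℂ) (μ ν : Fin (n + 1)) : ℂ :=
  (((calabiF n κ (sq z))⁻¹ : ℝ) : ℂ) * ((if μ = ν then 1 else 0)
    + ((κ / sq z ^ (n + 2) : ℝ) : ℂ) * (z μ * conj (z ν)))

lemma invMetric_calabiMetric (hκ : 0 < κ) {z : Fin (n + 1) → ℂ} (hz : z ≠ 0)
    (μ ν : Fin (n + 1)) : invMetric (calabiMetric n κ) z μ ν = calabiInv n κ z μ ν := by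
  have hs := sq_pos hz
  have hF := calabiF_pos (n := n) hκ hs
  have hFc : (calabiF n κ (sq z) : ℂ) ≠ 0 := by exact_mod_cast hF.ne'
  have hsc : (sq z : ℂ) ≠ 0 := by exact_mod_cast hs.ne'
  have hpow : (calabiF n κ (sq z) : ℂ) ^ (n + 1) = 1 + κ / (sq z : ℂ) ^ (n + 1) := by
    exact_mod_cast calabiF_pow (n := n) hκ hs
  have hmul : calabiMetric n κ z * Matrix.of (fun ν μ => calabiInv n κ z μ ν) = 1 := by
    ext i j
    rw [Matrix.mul_apply]
    simp only [calabiMetric, calabiInv, Matrix.of_apply, deriv_calabiF hκ hs, Matrix.one_apply]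
    -- Product of two rank-one perturbations of multiples of the identity, with z̄ · z = s. It
    -- remains to see that the rank-one coefficient vanishes.
    have hx : ∀ a b c d : ℂ, ∑ x, (a * (if i = x then 1 else 0) + b * (conj (z i) * z x)) *
        (c * ((if j = x then 1 else 0) + d * (z j * conj (z x))))
        = c * (a * (if i = j then 1 else 0)
          + conj (z i) * z j * (a * d + b + b * d * (sq z : ℂ))) := by
      intro a b c d
      rw [← sum_conj_mul]
      simp only [Finset.mul_sum, mul_add, add_mul, Finset.sum_add_distrib, mul_ite, mul_one,
        mul_zero, ite_mul, zero_mul, Finset.sum_ite_eq, Finset.mem_univ, if_true]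
      have e : (∑ x, b * (conj (z i) * z x) * (c * (d * (z j * conj (z x)))))
          = ∑ x, c * (conj (z i) * z j * (b * d * (conj (z x) * z x))) :=
        Finset.sum_congr rfl fun x _ => by ring
      rw [e]
      by_cases hij : i = j
      · subst hij; simp; ring
      · simp [hij]; ring
    rw [hx]
    -- This coefficient is κ / (s^(n+2) Fⁿ) times F^(n+1) - (1 + κ/s^(n+1)), which is zero by the
    -- definition of F.
    have hzero : (calabiF n κ (sq z) : ℂ) * ((κ / sq z ^ (n + 2) : ℝ) : ℂ)
        + ((-κ / (sq z ^ (n + 2) * calabiF n κ (sq z) ^ n) : ℝ) : ℂ)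
        + ((-κ / (sq z ^ (n + 2) * calabiF n κ (sq z) ^ n) : ℝ) : ℂ)
          * ((κ / sq z ^ (n + 2) : ℝ) : ℂ) * (sq z : ℂ) = 0 := by
      have : (calabiF n κ (sq z) : ℂ) ^ n * (calabiF n κ (sq z) : ℂ)
          = 1 + κ / (sq z : ℂ) ^ (n + 1) := by rw [← hpow, pow_succ]
      push_cast
      trans (κ : ℂ) / ((sq z : ℂ) ^ (n + 2) * (calabiF n κ (sq z) : ℂ) ^ n)
        * ((calabiF n κ (sq z) : ℂ) ^ n * (calabiF n κ (sq z) : ℂ)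
          - (1 + κ / (sq z : ℂ) ^ (n + 1)))
      · field_simp
        ring
      · rw [this, sub_self, mul_zero]
    rw [hzero]
    push_cast
    split_ifs <;> field_simp <;> simp
  rw [invMetric, Matrix.inv_eq_right_inv hmul, Matrix.of_apply]

/-- By the matrix determinant lemma, a rank-one perturbation of F times the identity gives F^(n+1)
(1 + sF'/F) = Fⁿ (F + sF'). -/
lemma det_calabiMetric (hκ : 0 < κ) {z : Fin (n + 1) → ℂ} (hz : z ≠ 0) :
    (calabiMetric n κ z).det = 1 := by
  have hs := sq_pos hz
  have hF := calabiF_pos (n := n) hκ hs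
  have hFc : (calabiF n κ (sq z) : ℂ) ≠ 0 := by exact_mod_cast hF.ne'
  set F : ℂ := (calabiF n κ (sq z) : ℂ) with hFdef
  set D : ℂ := ((deriv (calabiF n κ) (sq z) : ℝ) : ℂ) with hD
  have hG : calabiMetric n κ z = F • (1 + Matrix.replicateCol Unit (fun μ => D / F * conj (z μ)) *
      Matrix.replicateRow Unit z) := by
    ext i j
    simp only [calabiMetric, Matrix.of_apply, Matrix.smul_apply, Matrix.add_apply,
      Matrix.one_apply, Matrix.mul_apply, Matrix.replicateCol_apply, Matrix.replicateRow_apply,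
      smul_eq_mul, Finset.univ_unique, Finset.sum_singleton, ← hFdef, ← hD]
    field_simp
  rw [hG, Matrix.det_smul, Matrix.det_one_add_replicateCol_mul_replicateRow]
  have hdot : z ⬝ᵥ (fun μ => D / F * conj (z μ)) = D / F * (sq z : ℂ) := by
    rw [← sum_conj_mul, Finset.mul_sum]
    exact Finset.sum_congr rfl fun i _ => by ring
  have h : F ^ n * (F + (sq z : ℂ) * D) = 1 := by
    rw [hFdef, hD]
    exact_mod_cast calabiF_pow_mul (n := n) hκ hs
  rw [hdot, Fintype.card_fin]
  refine Eq.trans ?_ h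
  field_simp
  ring

/-- The eigenvalue on z is F⁻¹ (1 + κ/s^(n+1)) = F⁻¹ F^(n+1). -/
lemma sum_calabiInv_mul (hκ : 0 < κ) {z : Fin (n + 1) → ℂ} (hz : z ≠ 0) (μ : Fin (n + 1)) :
    ∑ ν, calabiInv n κ z μ ν * z ν = (calabiF n κ (sq z) : ℂ) ^ n * z μ := by
  have hs := sq_pos hz
  have hF := calabiF_pos (n := n) hκ hs
  have hFc : (calabiF n κ (sq z) : ℂ) ≠ 0 := by exact_mod_cast hF.ne'
  have hsc : (sq z : ℂ) ≠ 0 := by exact_mod_cast hs.ne'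
  have hpow : (calabiF n κ (sq z) : ℂ) ^ (n + 1) = 1 + κ / (sq z : ℂ) ^ (n + 1) := by
    exact_mod_cast calabiF_pow (n := n) hκ hs
  have hx : ∀ c d : ℂ, ∑ ν, c * ((if μ = ν then 1 else 0) + d * (z μ * conj (z ν))) * z ν
      = c * (1 + d * (sq z : ℂ)) * z μ := by
    intro c d
    rw [← sum_conj_mul]
    simp only [mul_add, add_mul, Finset.sum_add_distrib, mul_ite, mul_one, mul_zero, ite_mul,
      zero_mul, Finset.sum_ite_eq, Finset.mem_univ, if_true, Finset.mul_sum, Finset.sum_mul]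
    congr 1
    exact Finset.sum_congr rfl fun i _ => by ring
  simp only [calabiInv]
  rw [hx]
  push_cast
  have : 1 + (κ : ℂ) / (sq z : ℂ) ^ (n + 2) * (sq z : ℂ) = (calabiF n κ (sq z) : ℂ) ^ (n + 1) := by
    rw [hpow]; field_simp; ring
  rw [this, pow_succ]
  field_simp

end Metric

/-! ### The twist factor -/

section Twist

variable {n : ℕ} {κ : ℝ} {ℓ : ℤ} {f : ℝ → ℝ}

/-- The logarithmic derivative of a twist factor. -/
def twistLogDeriv (n : ℕ) (κ : ℝ) (ℓ : ℤ) (s : ℝ) : ℝ :=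
  (ℓ : ℝ) * κ ^ ((n : ℝ) / ((n : ℝ) + 1)) / (2 * calabiF n κ s ^ n * s ^ (n + 1))

lemma contDiffOn_twistLogDeriv (hκ : 0 < κ) :
    ContDiffOn ℝ ∞ (twistLogDeriv n κ ℓ) (Set.Ioi 0) := by
  refine contDiffOn_const.div
    ((contDiffOn_const.mul ((contDiffOn_calabiF hκ).pow n)).mul (contDiffOn_id.pow (n + 1))) ?_
  intro s (hs : 0 < s)
  have := calabiF_pos (n := n) hκ hs
  positivity

lemma exists_isTwistFactor (n : ℕ) (hκ : 0 < κ) (ℓ : ℤ) : ∃ f, IsTwistFactor n κ ℓ f := by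
  refine ⟨fun s => Real.exp (∫ t in (1 : ℝ)..s, twistLogDeriv n κ ℓ t), fun s hs =>
    ⟨Real.exp_pos _, ?_⟩⟩
  simp only [Real.log_exp]
  have hc : ContinuousOn (twistLogDeriv n κ ℓ) (Set.Ioi 0) :=
    (contDiffOn_twistLogDeriv hκ).continuousOn
  refine intervalIntegral.integral_hasDerivAt_right ?_ ?_ (hc.continuousAt (Ioi_mem_nhds hs))
  · refine (hc.mono fun t ht => ?_).intervalIntegrable
    exact lt_of_lt_of_le (lt_min one_pos hs) ht.1
  · exact hc.stronglyMeasurableAtFilter isOpen_Ioi s hs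

lemma IsTwistFactor.hasDerivAt_log (hf : IsTwistFactor n κ ℓ f) {s : ℝ} (hs : 0 < s) :
    HasDerivAt (fun t => Real.log (f t)) (twistLogDeriv n κ ℓ s) s :=
  (hf s hs).2

lemma IsTwistFactor.hasDerivAt (hf : IsTwistFactor n κ ℓ f) {s : ℝ} (hs : 0 < s) :
    HasDerivAt f (f s * twistLogDeriv n κ ℓ s) s := by
  have h := (hf.hasDerivAt_log hs).exp
  rw [Real.exp_log (hf s hs).1] at h
  refine h.congr_of_eventuallyEq ?_
  filter_upwards [Ioi_mem_nhds hs] with t ht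
  exact (Real.exp_log (hf t ht).1).symm

/-- The twist condition speaks only of log f; its derivative is an explicit smooth function, so log
f is smooth, and then so is its exponential. -/
lemma IsTwistFactor.contDiffOn (hκ : 0 < κ) (hf : IsTwistFactor n κ ℓ f) :
    ContDiffOn ℝ ∞ f (Set.Ioi 0) := by
  have h : ContDiffOn ℝ ∞ (fun t => Real.log (f t)) (Set.Ioi 0) := by
    rw [contDiffOn_infty_iff_deriv_of_isOpen isOpen_Ioi]
    exact ⟨fun s hs => (hf.hasDerivAt_log hs).differentiableAt.differentiableWithinAt,
      (contDiffOn_twistLogDeriv hκ).congr fun s hs => (hf.hasDerivAt_log hs).deriv⟩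
  exact h.exp.congr fun s hs => (Real.exp_log (hf s hs).1).symm

end Twist

/-! ### The zero modes -/

section ZeroMode

variable {n : ℕ} {κ : ℝ} {ℓ : ℤ} {δ : ℕ} {f : ℝ → ℝ} {P : MvPolynomial (Fin (n + 1)) ℂ}

/-- The radial factor `h₀ f` of the zero mode. -/
def modeRadial (n : ℕ) (κ : ℝ) (δ : ℕ) (f : ℝ → ℝ) (s : ℝ) : ℝ := hZero n κ δ s * f s

lemma zeroMode_apply (z : Fin (n + 1) → ℂ) (ν : Fin (n + 1)) :
    zeroMode n κ δ f P z ν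
      = MvPolynomial.eval z P * ((modeRadial n κ δ f (sq z) : ℝ) : ℂ) * z ν := by
  rw [zeroMode, dbarFun_sq, modeRadial]
  push_cast
  ring

lemma contDiffOn_modeRadial (hκ : 0 < κ) (hf : IsTwistFactor n κ ℓ f) :
    ContDiffOn ℝ ∞ (modeRadial n κ δ f) (Set.Ioi 0) := by
  refine ContDiffOn.mul (contDiffOn_const.div
    (((contDiffOn_calabiF hκ).pow n).mul (contDiffOn_id.pow (δ + n + 1))) ?_) (hf.contDiffOn hκ)
  intro s (hs : 0 < s)
  have := calabiF_pos (n := n) hκ hs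
  positivity

lemma contDiffOn_radial {φ : ℝ → ℝ} (hφ : ContDiffOn ℝ ∞ φ (Set.Ioi 0)) :
    ContDiffOn ℝ ∞ (fun z : Fin (n + 1) → ℂ => ((φ (sq z) : ℝ) : ℂ)) {z | z ≠ 0} :=
  Complex.ofRealCLM.contDiff.comp_contDiffOn
    (hφ.comp contDiff_sq.contDiffOn fun _ hz => sq_pos hz)

lemma contDiffOn_zeroMode (hκ : 0 < κ) (hf : IsTwistFactor n κ ℓ f) :
    ContDiffOn ℝ ∞ (zeroMode n κ δ f P) {z | z ≠ 0} := by
  rw [contDiffOn_pi]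
  intro ν
  simp only [zeroMode_apply]
  exact ((contDiff_eval P).contDiffOn.mul (contDiffOn_radial (contDiffOn_modeRadial hκ hf))).mul
    (contDiff_apply ℝ ℂ ν).contDiffOn

lemma isOpen_ne_zero : IsOpen {z : Fin (n + 1) → ℂ | z ≠ 0} := isOpen_ne

lemma differentiableAt_of_contDiffOn {E : Type*} [NormedAddCommGroup E] [NormedSpace ℝ E]
    {u : (Fin (n + 1) → ℂ) → E} (hu : ContDiffOn ℝ ∞ u {z | z ≠ 0})
    {z : Fin (n + 1) → ℂ} (hz : z ≠ 0) : DifferentiableAt ℝ u z :=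
  (hu.differentiableOn (by simp)).differentiableAt (isOpen_ne_zero.mem_nhds hz)

/-- Since P is holomorphic, only the radial factor is differentiated. The result is symmetric in μ
and ν: ∂̄s ∧ ∂̄s = 0. -/
lemma dbarForm_zeroMode (hκ : 0 < κ) (hf : IsTwistFactor n κ ℓ f) {z : Fin (n + 1) → ℂ}
    (hz : z ≠ 0) : dbarForm (zeroMode n κ δ f P) z = 0 := by
  have hs := sq_pos hz
  have hd : HasDerivAt (modeRadial n κ δ f) (deriv (modeRadial n κ δ f) (sq z)) (sq z) :=
    (((contDiffOn_modeRadial hκ hf).differentiableOn (by simp)).differentiableAt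
      (Ioi_mem_nhds hs)).hasDerivAt
  have hr := (hasFDerivAt_radial hd).differentiableAt
  have key : ∀ μ ν, dzbar μ (fun w => zeroMode n κ δ f P w ν) z
      = MvPolynomial.eval z P * ((deriv (modeRadial n κ δ f) (sq z) : ℝ) : ℂ) * z μ * z ν := by
    intro μ ν
    simp only [zeroMode_apply]
    rw [dzbar_mul ((differentiable_eval P z).fun_mul hr) (differentiable_apply ν z),
      dzbar_mul (differentiable_eval P z) hr, dzbar_eval, dzbar_coord, dzbar_radial hd]
    ring
  funext μ ν
  simp only [dbarForm, key, Pi.zero_apply]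
  ring

lemma contDiffOn_calabiInv (hκ : 0 < κ) (μ ν : Fin (n + 1)) :
    ContDiffOn ℝ ∞ (fun z => calabiInv n κ z μ ν) {z | z ≠ 0} := by
  unfold calabiInv
  refine (contDiffOn_radial ((contDiffOn_calabiF (n := n) hκ).inv
    fun s hs => (calabiF_pos hκ hs).ne')).mul (contDiffOn_const.add ?_)
  refine (contDiffOn_radial (φ := fun s => κ / s ^ (n + 2)) (contDiffOn_const.div
    (contDiffOn_id.pow (n + 2)) fun s (hs : 0 < s) => by positivity)).mul ?_
  exact ((contDiff_apply ℝ ℂ μ).mul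
    (Complex.conjCLE.contDiff.comp (contDiff_apply ℝ ℂ ν))).contDiffOn

/-- The factor F⁻ⁿ in h₀ is chosen to absorb the eigenvalue Fⁿ met when raising the index. -/
lemma calabiF_pow_mul_modeRadial (hκ : 0 < κ) {s : ℝ} (hs : 0 < s) :
    calabiF n κ s ^ n * modeRadial n κ δ f s = f s / s ^ (δ + n + 1) := by
  have := calabiF_pos (n := n) hκ hs
  rw [modeRadial, hZero]
  field_simp

lemma sum_invMetric_zeroMode (hκ : 0 < κ) {z : Fin (n + 1) → ℂ} (hz : z ≠ 0)
    (μ : Fin (n + 1)) :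
    ∑ ν, invMetric (calabiMetric n κ) z μ ν * zeroMode n κ δ f P z ν
      = z μ * MvPolynomial.eval z P * ((f (sq z) / sq z ^ (δ + n + 1) : ℝ) : ℂ) := by
  rw [← calabiF_pow_mul_modeRadial hκ (sq_pos hz)]
  simp only [invMetric_calabiMetric hκ hz, zeroMode_apply]
  trans (∑ ν, calabiInv n κ z μ ν * z ν)
    * (MvPolynomial.eval z P * ((modeRadial n κ δ f (sq z) : ℝ) : ℂ))
  · rw [Finset.sum_mul]
    exact Finset.sum_congr rfl fun ν _ => by ring
  · rw [sum_calabiInv_mul hκ hz]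
    push_cast
    ring

lemma dbarStar_zeroMode (hκ : 0 < κ) (hf : IsTwistFactor n κ ℓ f) (hP : P.IsHomogeneous δ)
    {z : Fin (n + 1) → ℂ} (hz : z ≠ 0) :
    dbarStar (calabiMetric n κ) (zeroMode n κ δ f P) z
      = -(MvPolynomial.eval z P
        * ((f (sq z) / sq z ^ (δ + n) * twistLogDeriv n κ ℓ (sq z) : ℝ) : ℂ)) := by
  have hs := sq_pos hz
  have hdiff : ∀ μ ν, DifferentiableAt ℝ
      (fun w => calabiInv n κ w μ ν * zeroMode n κ δ f P w ν) z := fun μ ν =>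
    differentiableAt_of_contDiffOn ((contDiffOn_calabiInv hκ μ ν).mul
      (contDiffOn_pi.mp (contDiffOn_zeroMode hκ hf) ν)) hz
  have hnhds : ∀ᶠ w in nhds z, w ≠ 0 := isOpen_ne_zero.mem_nhds hz
  set φ : ℝ → ℝ := fun s => f s / s ^ (δ + n + 1) with hφ
  -- Multiplied by s, the second term cancels n + 1 from ∑ ∂_μ z_μ and δ from Euler's identity.
  have hd : HasDerivAt φ (f (sq z) / sq z ^ (δ + n + 1) * twistLogDeriv n κ ℓ (sq z)
      - (δ + n + 1) * (f (sq z) / sq z ^ (δ + n + 2))) (sq z) := by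
    refine ((hf.hasDerivAt hs).div (hasDerivAt_pow (δ + n + 1) (sq z))
      (by positivity)).congr_deriv ?_
    push_cast
    field_simp
    ring
  have hr := (hasFDerivAt_radial hd).differentiableAt
  have key : ∀ μ, ∑ ν, dz μ (fun w => (calabiMetric n κ w).det
      * invMetric (calabiMetric n κ) w μ ν * zeroMode n κ δ f P w ν) z
      = dz μ (fun w => w μ * MvPolynomial.eval w P * ((φ (sq w) : ℝ) : ℂ)) z := by
    intro μ
    rw [← dz_congr (u := fun w => ∑ ν, calabiInv n κ w μ ν * zeroMode n κ δ f P w ν),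
      dz_sum _ _ fun ν _ => hdiff μ ν]
    · refine Finset.sum_congr rfl fun ν _ => dz_congr ?_
      filter_upwards [hnhds] with w hw
      rw [det_calabiMetric hκ hw, invMetric_calabiMetric hκ hw, one_mul]
    · filter_upwards [hnhds] with w hw
      rw [← sum_invMetric_zeroMode hκ hw]
      exact Finset.sum_congr rfl fun ν _ => by rw [invMetric_calabiMetric hκ hw]
  have heuler : ∑ μ, z μ * MvPolynomial.eval z (MvPolynomial.pderiv μ P)
      = (δ : ℂ) * MvPolynomial.eval z P := by
    have := congrArg (MvPolynomial.eval z) hP.sum_X_mul_pderiv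
    simpa using this
  simp only [dbarStar, key, det_calabiMetric hκ hz]
  have hterm : ∀ μ, dz μ (fun w => w μ * MvPolynomial.eval w P * ((φ (sq w) : ℝ) : ℂ)) z
      = MvPolynomial.eval z P * φ (sq z)
        + z μ * MvPolynomial.eval z (MvPolynomial.pderiv μ P) * φ (sq z)
        + conj (z μ) * z μ * (MvPolynomial.eval z P *
          ((f (sq z) / sq z ^ (δ + n + 1) * twistLogDeriv n κ ℓ (sq z)
            - (δ + n + 1) * (f (sq z) / sq z ^ (δ + n + 2)) : ℝ) : ℂ)) := by
    intro μ
    rw [dz_mul ((differentiable_apply μ z).fun_mul (differentiable_eval P z)) hr,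
      dz_mul (differentiable_apply μ z) (differentiable_eval P z), dz_coord, dz_eval,
      dz_radial hd, if_pos rfl]
    ring
  simp only [hterm, Finset.sum_add_distrib, ← Finset.sum_mul, heuler, sum_conj_mul]
  have hsc : (sq z : ℂ) ≠ 0 := by exact_mod_cast hs.ne'
  simp only [hφ, Finset.sum_const, Finset.card_univ, Fintype.card_fin, nsmul_eq_mul]
  push_cast
  field_simp
  ring

/-- The (1,0)-part of 𝒜 is -(log f)' z̄_μ, and ∑ z̄_μ z_μ = s lowers the exponent of s by one. The
value is that of ∂̄*σ, so -∂̄*σ + 𝒜·σ vanishes. -/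
lemma clifford_zeroMode_fst (hκ : 0 < κ) {z : Fin (n + 1) → ℂ} (hz : z ≠ 0) :
    (clifford (calabiMetric n κ) (calabiConnection n κ ℓ) (zeroMode n κ δ f P) z).1
      = -(MvPolynomial.eval z P
        * ((f (sq z) / sq z ^ (δ + n) * twistLogDeriv n κ ℓ (sq z) : ℝ) : ℂ)) := by
  have hs := sq_pos hz
  have hF := calabiF_pos (n := n) hκ hs
  have hsc : (sq z : ℂ) ≠ 0 := by exact_mod_cast hs.ne'
  have hFc : (calabiF n κ (sq z) : ℂ) ≠ 0 := by exact_mod_cast hF.ne'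
  have hsum : ∀ μ, ∑ ν, invMetric (calabiMetric n κ) z μ ν
      * (calabiConnection n κ ℓ).holo z μ * zeroMode n κ δ f P z ν
      = conj (z μ) * z μ * (-(MvPolynomial.eval z P
        * ((f (sq z) / sq z ^ (δ + n + 1) * twistLogDeriv n κ ℓ (sq z) : ℝ) : ℂ))) := by
    intro μ
    trans (calabiConnection n κ ℓ).holo z μ
      * ∑ ν, invMetric (calabiMetric n κ) z μ ν * zeroMode n κ δ f P z ν
    · rw [Finset.mul_sum]
      exact Finset.sum_congr rfl fun ν _ => by ring
    · rw [sum_invMetric_zeroMode hκ hz]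
      simp only [calabiConnection, connA, twistLogDeriv, map_mul, Complex.conj_ofReal]
      push_cast
      field_simp
  simp only [clifford, hsum, ← Finset.sum_mul, sum_conj_mul]
  push_cast
  field_simp
  ring

lemma clifford_zeroMode_snd (z : Fin (n + 1) → ℂ) :
    (clifford (calabiMetric n κ) (calabiConnection n κ ℓ) (zeroMode n κ δ f P) z).2 = 0 := by
  funext μ ν
  simp only [clifford, calabiConnection, connA, zeroMode_apply, Pi.zero_apply]
  ring

theorem isZeroMode_zeroMode (hκ : 0 < κ) (hf : IsTwistFactor n κ ℓ f)
    (hP : P.IsHomogeneous δ) :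
    IsZeroMode (calabiMetric n κ) (calabiConnection n κ ℓ) {z | z ≠ 0}
      (zeroMode n κ δ f P) := by
  refine ⟨contDiffOn_zeroMode hκ hf, fun z hz => ?_⟩
  apply Prod.ext
  · simp only [twistedDirac, dirac, Prod.fst_add, dbarStar_zeroMode hκ hf hP hz,
      clifford_zeroMode_fst hκ hz, Prod.fst_zero]
    ring
  · simp only [twistedDirac, dirac, Prod.snd_add, dbarForm_zeroMode hκ hf hz,
      clifford_zeroMode_snd, Prod.snd_zero, add_zero]

/-- `|σ|² = |P|² f² / (Fⁿ s^{2δ+2n+1})`. -/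
lemma formNormSq_zeroMode (hκ : 0 < κ) {z : Fin (n + 1) → ℂ} (hz : z ≠ 0) :
    formNormSq (calabiMetric n κ) (zeroMode n κ δ f P) z
      = ‖MvPolynomial.eval z P‖ ^ 2
        * (f (sq z) ^ 2 / (calabiF n κ (sq z) ^ n * sq z ^ (2 * δ + 2 * n + 1))) := by
  have hs := sq_pos hz
  have hF := calabiF_pos (n := n) hκ hs
  have hsc : (sq z : ℂ) ≠ 0 := by exact_mod_cast hs.ne'
  have hFc : (calabiF n κ (sq z) : ℂ) ≠ 0 := by exact_mod_cast hF.ne'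
  have h : formInner (calabiMetric n κ) (zeroMode n κ δ f P) (zeroMode n κ δ f P) z
      = ((‖MvPolynomial.eval z P‖ ^ 2
        * (f (sq z) ^ 2 / (calabiF n κ (sq z) ^ n * sq z ^ (2 * δ + 2 * n + 1))) : ℝ) : ℂ) := by
    rw [formInner, Finset.sum_comm]
    simp only [← Finset.sum_mul, sum_invMetric_zeroMode hκ hz]
    simp only [zeroMode_apply, map_mul, Complex.conj_ofReal]
    trans (∑ μ, conj (z μ) * z μ) * ((conj (MvPolynomial.eval z P) * MvPolynomial.eval z P)
      * ((f (sq z) / sq z ^ (δ + n + 1) * modeRadial n κ δ f (sq z) : ℝ) : ℂ))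
    · rw [Finset.sum_mul]
      exact Finset.sum_congr rfl fun ν _ => by push_cast; ring
    · rw [sum_conj_mul, Complex.conj_mul', modeRadial, hZero]
      push_cast
      field_simp
      ring
  rw [formNormSq, h, Complex.ofReal_re]

end ZeroMode

/-! ### Asymptotics of the radial profile -/

section Asymptotics

variable {n : ℕ} {κ s : ℝ} {ℓ : ℤ} {f : ℝ → ℝ}

/-- The quantity sF has no singularity at s = 0; comparing (n+1)-st powers turns this identity into
all the bounds on F below. -/
lemma mul_calabiF_pow (hκ : 0 < κ) (hs : 0 < s) :
    (s * calabiF n κ s) ^ (n + 1) = s ^ (n + 1) + κ := by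
  rw [mul_pow, calabiF_pow hκ hs]
  field_simp

lemma le_mul_calabiF (hκ : 0 < κ) (hs : 0 < s) : s ≤ s * calabiF n κ s := by
  have h := calabiF_pos (n := n) hκ hs
  refine le_of_pow_le_pow_left₀ n.succ_ne_zero (by positivity) ?_
  rw [Nat.succ_eq_add_one, mul_calabiF_pow hκ hs]
  linarith

lemma mul_calabiF_le (hκ : 0 < κ) (hs : 0 < s) (hs1 : s ≤ 1) : s * calabiF n κ s ≤ 1 + κ := by
  refine le_of_pow_le_pow_left₀ n.succ_ne_zero (by positivity) ?_
  rw [Nat.succ_eq_add_one, mul_calabiF_pow hκ hs]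
  have h1 : s ^ (n + 1) ≤ 1 := pow_le_one₀ hs.le hs1
  have h2 : 1 + κ ≤ (1 + κ) ^ (n + 1) := le_self_pow₀ (by linarith) n.succ_ne_zero
  linarith

lemma rpow_inv_pow_succ (n : ℕ) (hκ : 0 < κ) : (κ ^ (1 / ((n : ℝ) + 1))) ^ (n + 1) = κ := by
  rw [← Real.rpow_natCast, ← Real.rpow_mul hκ.le]
  have : 1 / ((n : ℝ) + 1) * ((n + 1 : ℕ) : ℝ) = 1 := by push_cast; field_simp
  rw [this, Real.rpow_one]

lemma rpow_inv_pow (n : ℕ) (hκ : 0 < κ) :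
    (κ ^ (1 / ((n : ℝ) + 1))) ^ n = κ ^ ((n : ℝ) / ((n : ℝ) + 1)) := by
  rw [← Real.rpow_natCast, ← Real.rpow_mul hκ.le]
  congr 1
  field_simp

lemma rpow_inv_le_mul_calabiF (hκ : 0 < κ) (hs : 0 < s) :
    κ ^ (1 / ((n : ℝ) + 1)) ≤ s * calabiF n κ s := by
  have h := calabiF_pos (n := n) hκ hs
  refine le_of_pow_le_pow_left₀ n.succ_ne_zero (by positivity) ?_
  rw [Nat.succ_eq_add_one, mul_calabiF_pow hκ hs, rpow_inv_pow_succ n hκ]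
  have : 0 < s ^ (n + 1) := by positivity
  linarith

/-- The ratio `s (log f)' / (ℓ / 2)`, which interpolates between `1` at `0` and `0` at `∞`. -/
def twistRatio (n : ℕ) (κ s : ℝ) : ℝ := (κ ^ (1 / ((n : ℝ) + 1)) / (s * calabiF n κ s)) ^ n

lemma twistLogDeriv_eq (hκ : 0 < κ) (hs : 0 < s) :
    twistLogDeriv n κ ℓ s = ℓ / 2 * (twistRatio n κ s / s) := by
  have h := calabiF_pos (n := n) hκ hs
  rw [twistLogDeriv, twistRatio, div_pow, rpow_inv_pow n hκ, mul_pow]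
  field_simp
  ring

lemma twistRatio_nonneg (hκ : 0 < κ) (hs : 0 < s) : 0 ≤ twistRatio n κ s := by
  have h := calabiF_pos (n := n) hκ hs
  unfold twistRatio
  positivity

lemma one_sub_twistRatio_nonneg (hκ : 0 < κ) (hs : 0 < s) : 0 ≤ 1 - twistRatio n κ s := by
  have h := calabiF_pos (n := n) hκ hs
  refine sub_nonneg.mpr (pow_le_one₀ (by positivity) ?_)
  exact (div_le_one (by positivity)).mpr (rpow_inv_le_mul_calabiF hκ hs)

/-- With x = κ^(1/(n+1)) / (sF) ≤ 1, xⁿ ≥ x^(n+1) = κ / (s^(n+1) + κ). The defect stays bounded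
after division by s near 0, as the comparison of f² with s^ℓ requires. -/
lemma one_sub_twistRatio_le (hκ : 0 < κ) (hs : 0 < s) :
    1 - twistRatio n κ s ≤ s ^ (n + 1) / κ := by
  have h := calabiF_pos (n := n) hκ hs
  have h1 : (κ ^ (1 / ((n : ℝ) + 1)) / (s * calabiF n κ s)) ^ (n + 1) ≤ twistRatio n κ s :=
    pow_le_pow_of_le_one (by positivity)
      ((div_le_one (by positivity)).mpr (rpow_inv_le_mul_calabiF hκ hs)) n.le_succ
  rw [div_pow, rpow_inv_pow_succ n hκ, mul_calabiF_pow hκ hs] at h1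
  have h2 : 1 - κ / (s ^ (n + 1) + κ) ≤ s ^ (n + 1) / κ := by
    have hp : 0 < s ^ (n + 1) := by positivity
    have : 1 - κ / (s ^ (n + 1) + κ) = s ^ (n + 1) / (s ^ (n + 1) + κ) := by field_simp; ring
    rw [this]
    exact div_le_div_of_nonneg_left hp.le hκ (by linarith)
  linarith

/-- Here n ≥ 1 enters, through (sF)ⁿ ≥ sⁿ ≥ s; it makes (log f)' of order s⁻² at infinity. -/
lemma twistRatio_le (hn : 1 ≤ n) (hκ : 0 < κ) (hs : 1 ≤ s) :
    twistRatio n κ s ≤ κ ^ ((n : ℝ) / ((n : ℝ) + 1)) / s := by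
  have hs0 : 0 < s := by linarith
  have h := calabiF_pos (n := n) hκ hs0
  rw [twistRatio, div_pow, rpow_inv_pow n hκ]
  refine div_le_div_of_nonneg_left (by positivity) hs0 ?_
  calc s ≤ s ^ n := le_self_pow₀ hs (by omega)
    _ ≤ _ := pow_le_pow_left₀ hs0.le (le_mul_calabiF hκ hs0) n

/-- Near `0`, `f²` is comparable with `s^ℓ`. -/
lemma IsTwistFactor.sq_comparable_near_zero (hκ : 0 < κ) (hf : IsTwistFactor n κ ℓ f) :
    ∃ c C : ℝ, 0 < c ∧ 0 < C ∧ ∀ s, 0 < s → s ≤ 1 →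
      c * s ^ (ℓ : ℝ) ≤ f s ^ 2 ∧ f s ^ 2 ≤ C * s ^ (ℓ : ℝ) := by
  -- This is log (f² / s^ℓ). Its derivative -ℓ (1 - `twistRatio`) / s is at most |ℓ|/κ in absolute
  -- value on (0, 1], so g stays within |ℓ|/κ of g(1).
  set g : ℝ → ℝ := fun s => 2 * Real.log (f s) - ℓ * Real.log s with hg
  have hfg : ∀ s, 0 < s → f s ^ 2 = Real.exp (g s) * s ^ (ℓ : ℝ) := by
    intro s hs
    rw [Real.rpow_def_of_pos hs, ← Real.exp_add, hg]
    simp only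
    rw [show 2 * Real.log (f s) - ℓ * Real.log s + Real.log s * ℓ
      = Real.log (f s) + Real.log (f s) by ring, Real.exp_add, Real.exp_log (hf s hs).1, pow_two]
  have hd : ∀ s ∈ Set.Ioc (0 : ℝ) 1, HasDerivWithinAt g
      (2 * twistLogDeriv n κ ℓ s - ℓ * s⁻¹) (Set.Ioc 0 1) s := fun s hs =>
    (((hf.hasDerivAt_log hs.1).const_mul 2).sub
      ((Real.hasDerivAt_log hs.1.ne').const_mul (ℓ : ℝ))).hasDerivWithinAt
  have hb : ∀ s ∈ Set.Ioc (0 : ℝ) 1, ‖2 * twistLogDeriv n κ ℓ s - ℓ * s⁻¹‖ ≤ |(ℓ : ℝ)| / κ := by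
    intro s hs
    have hs0 := hs.1
    rw [twistLogDeriv_eq hκ hs0]
    rw [show 2 * (ℓ / 2 * (twistRatio n κ s / s)) - ℓ * s⁻¹
      = -(ℓ * ((1 - twistRatio n κ s) / s)) by field_simp; ring, norm_neg, norm_mul,
      Real.norm_eq_abs, Real.norm_eq_abs, div_eq_mul_inv _ κ]
    refine mul_le_mul_of_nonneg_left ?_ (abs_nonneg _)
    rw [abs_of_nonneg (div_nonneg (one_sub_twistRatio_nonneg hκ hs0) hs0.le), div_le_iff₀ hs0]
    refine (one_sub_twistRatio_le hκ hs0).trans ?_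
    rw [pow_succ, mul_div_assoc, inv_mul_eq_div]
    exact mul_le_of_le_one_left (by positivity) (pow_le_one₀ hs0.le hs.2)
  have hbound : ∀ s, 0 < s → s ≤ 1 → |g s - g 1| ≤ |(ℓ : ℝ)| / κ := by
    intro s hs hs1
    have h := (convex_Ioc (0 : ℝ) 1).norm_image_sub_le_of_norm_hasDerivWithin_le hd hb
      (Set.right_mem_Ioc.mpr one_pos) ⟨hs, hs1⟩
    refine h.trans (mul_le_of_le_one_right (by positivity) ?_)
    rw [Real.norm_eq_abs, abs_le]
    constructor <;> linarith
  refine ⟨Real.exp (g 1 - |(ℓ : ℝ)| / κ), Real.exp (g 1 + |(ℓ : ℝ)| / κ), Real.exp_pos _,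
    Real.exp_pos _, fun s hs hs1 => ?_⟩
  have h := abs_le.mp (hbound s hs hs1)
  have hp : 0 ≤ s ^ (ℓ : ℝ) := Real.rpow_nonneg hs.le _
  rw [hfg s hs]
  exact ⟨mul_le_mul_of_nonneg_right (Real.exp_le_exp.mpr (by linarith)) hp,
    mul_le_mul_of_nonneg_right (Real.exp_le_exp.mpr (by linarith)) hp⟩

/-- `f²` is bounded near infinity. -/
lemma IsTwistFactor.sq_bounded_at_top (hn : 1 ≤ n) (hκ : 0 < κ) (hf : IsTwistFactor n κ ℓ f) :
    ∃ C : ℝ, 0 < C ∧ ∀ s, 1 ≤ s → f s ^ 2 ≤ C := by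
  set K : ℝ := κ ^ ((n : ℝ) / ((n : ℝ) + 1)) with hK
  have hK0 : 0 < K := Real.rpow_pos_of_pos hκ _
  -- The added term has derivative -|ℓ|K/s², which dominates 2 (log f)'. So h decreases on [1, ∞)
  -- and bounds log f² from above.
  set h : ℝ → ℝ := fun s => 2 * Real.log (f s) + |(ℓ : ℝ)| * K * s⁻¹ with hh
  have hd : ∀ s, 0 < s → HasDerivAt h
      (2 * twistLogDeriv n κ ℓ s + |(ℓ : ℝ)| * K * (-(s ^ 2)⁻¹)) s := fun s hs =>
    ((hf.hasDerivAt_log hs).const_mul 2).add ((hasDerivAt_inv hs.ne').const_mul _)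
  have hanti : AntitoneOn h (Set.Ici 1) := by
    refine antitoneOn_of_deriv_nonpos (convex_Ici 1)
      (fun s (hs : 1 ≤ s) => (hd s (by linarith)).continuousAt.continuousWithinAt) ?_ ?_
    · intro s hs
      rw [interior_Ici] at hs
      exact (hd s (zero_lt_one.trans hs)).differentiableAt.differentiableWithinAt
    · intro s hs
      rw [interior_Ici] at hs
      have hs1 : 1 ≤ s := le_of_lt hs
      have hs0 : 0 < s := zero_lt_one.trans hs
      rw [(hd s hs0).deriv, twistLogDeriv_eq hκ hs0]
      have h1 : (ℓ : ℝ) * (twistRatio n κ s / s) ≤ |(ℓ : ℝ)| * (K / s / s) :=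
        mul_le_mul (le_abs_self _)
          (div_le_div_of_nonneg_right (twistRatio_le hn hκ hs1) hs0.le)
          (div_nonneg (twistRatio_nonneg hκ hs0) hs0.le) (abs_nonneg _)
      have h2 : |(ℓ : ℝ)| * K * (-(s ^ 2)⁻¹) = -(|(ℓ : ℝ)| * (K / s / s)) := by
        field_simp
      rw [h2]
      linarith
  refine ⟨Real.exp (h 1), Real.exp_pos _, fun s hs => ?_⟩
  have hs0 : 0 < s := by linarith
  have h1 : 2 * Real.log (f s) ≤ h s := by
    rw [hh]
    have : 0 ≤ |(ℓ : ℝ)| * K * s⁻¹ := by positivity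
    simp only
    linarith
  have h2 : h s ≤ h 1 := hanti (Set.mem_Ici.mpr le_rfl) hs hs
  calc f s ^ 2 = Real.exp (2 * Real.log (f s)) := by
        rw [two_mul, Real.exp_add, Real.exp_log (hf s hs0).1, pow_two]
    _ ≤ _ := Real.exp_le_exp.mpr (h1.trans h2)

/-- The radial profile of `|σ|²` in the variable `r = |z|`, including the Jacobian of polar
coordinates. -/
def radialProfile (n : ℕ) (κ : ℝ) (δ : ℕ) (f : ℝ → ℝ) (r : ℝ) : ℝ :=
  r ^ (2 * n + 1) * (r ^ (2 * δ)
    * (f (r ^ 2) ^ 2 / (calabiF n κ (r ^ 2) ^ n * (r ^ 2) ^ (2 * δ + 2 * n + 1))))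

variable {δ : ℕ} {r : ℝ}

lemma radialProfile_nonneg (hκ : 0 < κ) (hr : 0 < r) : 0 ≤ radialProfile n κ δ f r := by
  have h := calabiF_pos (n := n) hκ (pow_pos hr 2)
  unfold radialProfile
  positivity

/-- Grouping Fⁿ with r^(2n) leaves a factor (sF)ⁿ bounded above and away from zero near 0. -/
lemma radialProfile_eq (hκ : 0 < κ) (hr : 0 < r) : radialProfile n κ δ f r
    = f (r ^ 2) ^ 2 / ((r ^ 2 * calabiF n κ (r ^ 2)) ^ n * r ^ (2 * δ + 1)) := by
  have h := calabiF_pos (n := n) hκ (pow_pos hr 2)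
  unfold radialProfile
  field_simp
  ring

lemma continuousOn_radialProfile (hκ : 0 < κ) (hf : IsTwistFactor n κ ℓ f) :
    ContinuousOn (radialProfile n κ δ f) (Set.Ioi 0) := by
  have hm : Set.MapsTo (fun r : ℝ => r ^ 2) (Set.Ioi 0) (Set.Ioi 0) :=
    fun r (hr : 0 < r) => pow_pos hr 2
  have hp : ContinuousOn (fun r : ℝ => r ^ 2) (Set.Ioi 0) := (continuous_pow 2).continuousOn
  have h1 := (hf.contDiffOn hκ).continuousOn.comp hp hm
  have h2 := (contDiffOn_calabiF (n := n) hκ).continuousOn.comp hp hm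
  refine (continuous_pow _).continuousOn.mul ((continuous_pow _).continuousOn.mul
    ((h1.pow 2).div ((h2.pow n).mul (hp.pow _)) ?_))
  intro r (hr : 0 < r)
  have h := calabiF_pos (n := n) hκ (pow_pos hr 2)
  exact (mul_pos (pow_pos h _) (pow_pos (pow_pos hr 2) _)).ne'

lemma rpow_exponent (hr : 0 < r) :
    r ^ (2 * (ℓ : ℝ) - 2 * δ - 1) = (r ^ 2) ^ (ℓ : ℝ) / r ^ (2 * δ + 1) := by
  rw [← Real.rpow_natCast r 2, ← Real.rpow_mul hr.le, ← Real.rpow_natCast r (2 * δ + 1),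
    ← Real.rpow_sub hr]
  congr 1
  push_cast
  ring

theorem integrableOn_radialProfile_iff (hn : 1 ≤ n) (hκ : 0 < κ) (hf : IsTwistFactor n κ ℓ f) :
    IntegrableOn (radialProfile n κ δ f) (Set.Ioi 0) ↔ (δ : ℤ) < ℓ := by
  obtain ⟨c, C, hc, hC, hnear⟩ := hf.sq_comparable_near_zero hκ
  obtain ⟨B, hB, htop⟩ := hf.sq_bounded_at_top hn hκ
  have hcont := continuousOn_radialProfile (δ := δ) hκ hf
  have hexp : (δ : ℤ) < ℓ ↔ -1 < 2 * (ℓ : ℝ) - 2 * δ - 1 := by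
    constructor
    · intro h
      have : (δ : ℝ) < ℓ := by exact_mod_cast h
      linarith
    · intro h
      have : (δ : ℝ) < ℓ := by linarith
      exact_mod_cast this
  rw [hexp, ← intervalIntegral.integrableOn_Ioo_rpow_iff (one_pos)]
  have hk : 0 < κ ^ (1 / ((n : ℝ) + 1)) := Real.rpow_pos_of_pos hκ _
  constructor
  · intro h
    -- Necessity is decided at 0 alone: (1+κ)ⁿ bounds (sF)ⁿ from above, and c comes from f² ≥ c s^ℓ.
    have h' : IntegrableOn (fun r => (1 + κ) ^ n / c * radialProfile n κ δ f r)
        (Set.Ioo (0 : ℝ) 1) := (h.mono_set Set.Ioo_subset_Ioi_self).const_mul _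
    refine Integrable.mono' h' ?_ ?_
    · refine ContinuousOn.aestronglyMeasurable (fun r hr => ?_) measurableSet_Ioo
      exact (Real.continuousAt_rpow_const r _ (Or.inl hr.1.ne')).continuousWithinAt
    · refine ae_restrict_of_forall_mem measurableSet_Ioo fun r hr => ?_
      have hr0 : 0 < r := hr.1
      have hs0 : 0 < r ^ 2 := pow_pos hr0 2
      have hs1 : r ^ 2 ≤ 1 := pow_le_one₀ hr0.le hr.2.le
      have hF := calabiF_pos (n := n) hκ hs0
      rw [Real.norm_of_nonneg (Real.rpow_nonneg hr0.le _), rpow_exponent hr0,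
        radialProfile_eq hκ hr0]
      have h1 := (hnear _ hs0 hs1).1
      have h2 : (r ^ 2 * calabiF n κ (r ^ 2)) ^ n ≤ (1 + κ) ^ n :=
        pow_le_pow_left₀ (by positivity) (mul_calabiF_le hκ hs0 hs1) n
      calc (r ^ 2) ^ (ℓ : ℝ) / r ^ (2 * δ + 1)
          ≤ f (r ^ 2) ^ 2 / c / r ^ (2 * δ + 1) := by
            gcongr
            rw [le_div_iff₀ hc]
            linarith
        _ = (r ^ 2 * calabiF n κ (r ^ 2)) ^ n / c * (f (r ^ 2) ^ 2
            / ((r ^ 2 * calabiF n κ (r ^ 2)) ^ n * r ^ (2 * δ + 1))) := by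
            field_simp
        _ ≤ _ := by gcongr
  · intro h
    rw [← Set.Ioc_union_Ioi_eq_Ioi zero_le_one]
    refine IntegrableOn.union ?_ ?_
    · rw [integrableOn_Ioc_iff_integrableOn_Ioo]
      -- The constant combines f² ≤ C s^ℓ with the lower bound κ^(1/(n+1)) ≤ sF.
      refine Integrable.mono' (h.const_mul (C / (κ ^ (1 / ((n : ℝ) + 1))) ^ n)) ?_ ?_
      · exact (hcont.mono Set.Ioo_subset_Ioi_self).aestronglyMeasurable measurableSet_Ioo
      · refine ae_restrict_of_forall_mem measurableSet_Ioo fun r hr => ?_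
        have hr0 : 0 < r := hr.1
        have hs0 : 0 < r ^ 2 := pow_pos hr0 2
        have hs1 : r ^ 2 ≤ 1 := pow_le_one₀ hr0.le hr.2.le
        rw [Real.norm_of_nonneg (radialProfile_nonneg hκ hr0), rpow_exponent hr0,
          radialProfile_eq hκ hr0, div_mul_div_comm]
        have h1 := (hnear _ hs0 hs1).2
        have h2 : (κ ^ (1 / ((n : ℝ) + 1))) ^ n ≤ (r ^ 2 * calabiF n κ (r ^ 2)) ^ n :=
          pow_le_pow_left₀ hk.le (rpow_inv_le_mul_calabiF hκ hs0) n
        gcongr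
    · refine Integrable.mono' ((integrableOn_Ioi_rpow_of_lt (by norm_num : (-2 : ℝ) < -1)
        one_pos).const_mul B) ?_ ?_
      · exact (hcont.mono (Set.Ioi_subset_Ioi zero_le_one)).aestronglyMeasurable
          measurableSet_Ioi
      · refine ae_restrict_of_forall_mem measurableSet_Ioi fun r (hr : 1 < r) => ?_
        have hr0 : 0 < r := by linarith
        have hs0 : 0 < r ^ 2 := pow_pos hr0 2
        have hs1 : 1 ≤ r ^ 2 := one_le_pow₀ hr.le
        rw [Real.norm_of_nonneg (radialProfile_nonneg hκ hr0), radialProfile_eq hκ hr0,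
          Real.rpow_neg hr0.le, Real.rpow_two, ← div_eq_mul_inv]
        have h1 : r ^ 2 ≤ (r ^ 2 * calabiF n κ (r ^ 2)) ^ n :=
          (le_self_pow₀ hs1 (by omega)).trans
            (pow_le_pow_left₀ hs0.le (le_mul_calabiF hκ hs0) n)
        have h2 : (1 : ℝ) ≤ r ^ (2 * δ + 1) := one_le_pow₀ hr.le
        have h3 := htop _ hs1
        have h4 : r ^ 2 ≤ (r ^ 2 * calabiF n κ (r ^ 2)) ^ n * r ^ (2 * δ + 1) :=
          h1.trans (le_mul_of_one_le_right (hs0.le.trans h1) h2)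
        gcongr

end Asymptotics

/-! ### Integration in polar coordinates -/

section Polar

variable {E : Type*} [NormedAddCommGroup E] [NormedSpace ℝ E] [FiniteDimensional ℝ E]
  [MeasurableSpace E] [BorelSpace E]

/-- Polar coordinates for the product of a homogeneous function of degree `k` and a radial
function. -/
theorem lintegral_homogeneous_mul_radial (μ : Measure E) [μ.IsAddHaarMeasure] (k : ℕ)
    {a : E → ℝ≥0∞} (ha : Measurable a)
    (hom : ∀ (r : ℝ) (x : E), 0 < r → a (r • x) = ENNReal.ofReal (r ^ k) * a x)
    {w : ℝ → ℝ≥0∞} (hw : Measurable (fun r : Set.Ioi (0 : ℝ) => w r)) :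
    ∫⁻ x in {0}ᶜ, a x * w ‖x‖ ∂μ = (∫⁻ x : Metric.sphere (0 : E) 1, a x ∂μ.toSphere)
      * ∫⁻ r in Set.Ioi (0 : ℝ), ENNReal.ofReal (r ^ (Module.finrank ℝ E - 1))
        * (ENNReal.ofReal (r ^ k) * w r) := by
  rw [← lintegral_subtype_comap (measurableSet_singleton (0 : E)).compl]
  have hpt : ∀ x : ({0}ᶜ : Set E), a x * w ‖(x : E)‖
      = (fun p : Metric.sphere (0 : E) 1 × Set.Ioi (0 : ℝ) =>
          a p.1 * (ENNReal.ofReal ((p.2 : ℝ) ^ k) * w p.2)) (homeomorphUnitSphereProd E x) := by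
    intro x
    have hx : 0 < ‖(x : E)‖ := norm_pos_iff.mpr x.2
    -- Homogeneity applied to x = ‖x‖ · (x/‖x‖) separates the angular from the radial variable.
    have h := hom ‖(x : E)‖ (‖(x : E)‖⁻¹ • (x : E)) hx
    rw [smul_smul, mul_inv_cancel₀ hx.ne', one_smul] at h
    simp only [homeomorphUnitSphereProd_apply_fst_coe, homeomorphUnitSphereProd_apply_snd_coe]
    rw [h]
    ring
  rw [lintegral_congr hpt, μ.measurePreserving_homeomorphUnitSphereProd.lintegral_comp_emb
    (Homeomorph.measurableEmbedding _) (fun p : Metric.sphere (0 : E) 1 × Set.Ioi (0 : ℝ) =>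
      a p.1 * (ENNReal.ofReal ((p.2 : ℝ) ^ k) * w p.2))]
  have hg : Measurable (fun r : Set.Ioi (0 : ℝ) => ENNReal.ofReal ((r : ℝ) ^ k) * w r) :=
    Measurable.mul (by fun_prop) hw
  rw [lintegral_prod_mul (f := fun x : Metric.sphere (0 : E) 1 => a x)
    (g := fun r : Set.Ioi (0 : ℝ) => ENNReal.ofReal ((r : ℝ) ^ k) * w r)
    (ha.comp measurable_subtype_coe).aemeasurable hg.aemeasurable]
  congr 1
  rw [Measure.volumeIoiPow, lintegral_withDensity_eq_lintegral_mul _ (by fun_prop) hg,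
    ← lintegral_subtype_comap measurableSet_Ioi]
  rfl

end Polar

/-! ### Square integrability of the zero modes -/

section SquareIntegrable

variable {n : ℕ} {κ : ℝ} {ℓ : ℤ} {δ : ℕ} {f : ℝ → ℝ} {P : MvPolynomial (Fin (n + 1)) ℂ}

lemma eval_smul_of_isHomogeneous {m : ℕ} {P : MvPolynomial (Fin m) ℂ} (hP : P.IsHomogeneous δ)
    (c : ℂ) (z : Fin m → ℂ) :
    MvPolynomial.eval (c • z) P = c ^ δ * MvPolynomial.eval z P := by
  rw [MvPolynomial.eval_eq', MvPolynomial.eval_eq', Finset.mul_sum]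
  refine Finset.sum_congr rfl fun d hd => ?_
  have hdeg : ∑ i, d i = δ := by
    by_contra hne
    refine MvPolynomial.mem_support_iff.mp hd (hP.coeff_eq_zero ?_)
    rwa [Finsupp.degree_eq_sum]
  simp only [Pi.smul_apply, smul_eq_mul, mul_pow, Finset.prod_mul_distrib,
    Finset.prod_pow_eq_pow_sum, hdeg]
  ring

lemma sq_smul (c : ℂ) (z : Fin (n + 1) → ℂ) : sq (c • z) = ‖c‖ ^ 2 * sq z := by
  simp [sq, mul_pow, Finset.mul_sum]

/-- The norm of `Fin (n + 1) → ℂ` is the sup norm, whereas s is the square of the Euclidean one;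
hence polar coordinates are taken in `EuclideanSpace`. -/
lemma norm_toLp_sq (z : Fin (n + 1) → ℂ) : ‖WithLp.toLp 2 z‖ ^ 2 = sq z := by
  rw [EuclideanSpace.norm_sq_eq]
  rfl

lemma formNormSq_zeroMode_smul (hκ : 0 < κ) (hP : P.IsHomogeneous δ) {z : Fin (n + 1) → ℂ}
    (hz : z ≠ 0) {ε : ℂ} (hε : ‖ε‖ = 1) :
    formNormSq (calabiMetric n κ) (zeroMode n κ δ f P) (ε • z)
      = formNormSq (calabiMetric n κ) (zeroMode n κ δ f P) z := by
  have hε0 : ε ≠ 0 := by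
    rintro rfl
    simp at hε
  rw [formNormSq_zeroMode hκ hz, formNormSq_zeroMode hκ (smul_ne_zero hε0 hz), sq_smul,
    eval_smul_of_isHomogeneous hP]
  simp [hε]

/-- The image of Lebesgue measure on `ℂ^{n+1}` under the identification with Euclidean space. -/
def euclideanVolume (n : ℕ) : Measure (EuclideanSpace ℂ (Fin (n + 1))) :=
  volume.map (PiLp.continuousLinearEquiv 2 ℝ fun _ : Fin (n + 1) => ℂ).symm

instance : (euclideanVolume n).IsAddHaarMeasure :=
  (PiLp.continuousLinearEquiv 2 ℝ fun _ : Fin (n + 1) => ℂ).symm.isAddHaarMeasure_map volume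

/-- The integral of `|P|²` over the unit sphere. -/
def sphereIntegral (P : MvPolynomial (Fin (n + 1)) ℂ) : ℝ≥0∞ :=
  ∫⁻ x : Metric.sphere (0 : EuclideanSpace ℂ (Fin (n + 1))) 1,
    ENNReal.ofReal (‖MvPolynomial.eval (WithLp.ofLp x.1) P‖ ^ 2)
      ∂(euclideanVolume n).toSphere

lemma continuous_normSq_eval (P : MvPolynomial (Fin (n + 1)) ℂ) :
    Continuous fun x : EuclideanSpace ℂ (Fin (n + 1)) =>
      ENNReal.ofReal (‖MvPolynomial.eval (WithLp.ofLp x) P‖ ^ 2) :=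
  ENNReal.continuous_ofReal.comp ((((differentiable_eval P).continuous.comp
    (PiLp.continuous_ofLp 2 _)).norm).pow 2)

lemma sphereIntegral_ne_top (P : MvPolynomial (Fin (n + 1)) ℂ) : sphereIntegral P ≠ ⊤ := by
  obtain ⟨C, hC⟩ := (isCompact_sphere
    (0 : EuclideanSpace ℂ (Fin (n + 1))) 1).exists_bound_of_continuousOn
    (f := fun x => ‖MvPolynomial.eval (WithLp.ofLp x) P‖ ^ 2)
    ((((differentiable_eval P).continuous.comp (PiLp.continuous_ofLp 2 _)).norm).pow 2).continuousOn
  refine ne_top_of_le_ne_top ?_ (lintegral_mono (g := fun _ => ENNReal.ofReal C) fun x =>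
    ENNReal.ofReal_le_ofReal ((le_abs_self _).trans (hC x.1 x.2)))
  rw [lintegral_const]
  exact ENNReal.mul_ne_top ENNReal.ofReal_ne_top (measure_ne_top _ _)

/-- A zero integral makes the continuous function |P|² vanish on the whole sphere, as the sphere
measure charges open sets. Homogeneity extends this to z ≠ 0. -/
lemma sphereIntegral_ne_zero (hP : P.IsHomogeneous δ) (hP0 : P ≠ 0) : sphereIntegral P ≠ 0 := by
  intro h
  have hc := (continuous_normSq_eval P).comp
    (continuous_subtype_val (p := (· ∈ Metric.sphere (0 : EuclideanSpace ℂ (Fin (n + 1))) 1)))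
  have h0 := (hc.ae_eq_iff_eq _ continuous_zero).mp ((lintegral_eq_zero_iff hc.measurable).mp h)
  have hsphere : ∀ x : EuclideanSpace ℂ (Fin (n + 1)), ‖x‖ = 1 →
      MvPolynomial.eval (WithLp.ofLp x) P = 0 := by
    intro x hx
    have := congrFun h0 ⟨x, by simpa using hx⟩
    simpa [ENNReal.ofReal_eq_zero] using this
  have hne : ∀ z : Fin (n + 1) → ℂ, z ≠ 0 → MvPolynomial.eval z P = 0 := by
    intro z hz
    set x : EuclideanSpace ℂ (Fin (n + 1)) := WithLp.toLp 2 z with hx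
    have hx0 : x ≠ 0 := by
      intro h
      exact hz (by simpa [hx] using h)
    have hnx : (‖x‖ : ℂ) ≠ 0 := by exact_mod_cast norm_ne_zero_iff.mpr hx0
    have h1 := hsphere ((‖x‖ : ℂ)⁻¹ • x) (by
      rw [norm_smul, norm_inv, Complex.norm_real, norm_norm,
        inv_mul_cancel₀ (norm_ne_zero_iff.mpr hx0)])
    rw [WithLp.ofLp_smul, eval_smul_of_isHomogeneous hP] at h1
    exact (mul_eq_zero.mp h1).resolve_left (pow_ne_zero _ (inv_ne_zero hnx))
  refine hP0 (MvPolynomial.funext fun z => ?_)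
  have hcont : Continuous fun w : Fin (n + 1) → ℂ => MvPolynomial.eval w P :=
    (differentiable_eval P).continuous
  -- The origin is reached by density, which also covers δ = 0.
  have heq : (fun w : Fin (n + 1) → ℂ => MvPolynomial.eval w P) = fun _ => 0 :=
    hcont.ext_on (dense_compl_singleton (0 : Fin (n + 1) → ℂ)) continuous_const
      fun w hw => hne w hw
  simpa using congrFun heq z

lemma continuousOn_norm_profile (hκ : 0 < κ) (hf : IsTwistFactor n κ ℓ f) :
    ContinuousOn (fun s : ℝ => f s ^ 2 / (calabiF n κ s ^ n * s ^ (2 * δ + 2 * n + 1)))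
      (Set.Ioi 0) := by
  refine ((hf.contDiffOn hκ).continuousOn.pow 2).div
    (((contDiffOn_calabiF (n := n) hκ).continuousOn.pow n).mul
      (continuous_pow _).continuousOn) fun s (hs : 0 < s) => ?_
  have := calabiF_pos (n := n) hκ hs
  positivity

lemma setLIntegral_formNormSq_zeroMode (hκ : 0 < κ) (hf : IsTwistFactor n κ ℓ f)
    (hP : P.IsHomogeneous δ) :
    ∫⁻ z in {z | z ≠ 0}, ENNReal.ofReal (formNormSq (calabiMetric n κ) (zeroMode n κ δ f P) z)
      = sphereIntegral P
        * ∫⁻ r in Set.Ioi (0 : ℝ), ENNReal.ofReal (radialProfile n κ δ f r) := by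
  set e := (PiLp.continuousLinearEquiv 2 ℝ fun _ : Fin (n + 1) => ℂ).symm with he
  set w : ℝ → ℝ := fun s => f s ^ 2 / (calabiF n κ s ^ n * s ^ (2 * δ + 2 * n + 1)) with hw
  -- The real dimension is 2n + 2, whence the Jacobian r^(2n+1).
  have hfin : Module.finrank ℝ (EuclideanSpace ℂ (Fin (n + 1))) - 1 = 2 * n + 1 := by
    rw [← Module.finrank_mul_finrank ℝ ℂ]
    simp
    omega
  have hpolar := lintegral_homogeneous_mul_radial
    (euclideanVolume n) (2 * δ)
    (continuous_normSq_eval P).measurable (w := fun r => ENNReal.ofReal (w (r ^ 2))) ?_ ?_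
  · rw [hfin] at hpolar
    have hR : ∀ r ∈ Set.Ioi (0 : ℝ), ENNReal.ofReal (r ^ (2 * n + 1))
        * (ENNReal.ofReal (r ^ (2 * δ)) * ENNReal.ofReal (w (r ^ 2)))
        = ENNReal.ofReal (radialProfile n κ δ f r) := by
      intro r (hr : 0 < r)
      rw [← ENNReal.ofReal_mul (by positivity), ← ENNReal.ofReal_mul (by positivity)]
      rfl
    rw [setLIntegral_congr_fun measurableSet_Ioi hR] at hpolar
    have hemb : MeasurableEmbedding e := e.toHomeomorph.measurableEmbedding
    rw [sphereIntegral, ← hpolar, euclideanVolume, ← he, hemb.restrict_map, hemb.lintegral_map]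
    have hpre : e ⁻¹' {0}ᶜ = {z : Fin (n + 1) → ℂ | z ≠ 0} := by
      ext z
      simp
    rw [hpre]
    refine setLIntegral_congr_fun isOpen_ne_zero.measurableSet fun z hz => ?_
    simp only [formNormSq_zeroMode hκ hz, he, PiLp.coe_symm_continuousLinearEquiv, norm_toLp_sq]
    rw [ENNReal.ofReal_mul (by positivity)]
  · intro r x hr
    have : WithLp.ofLp (r • x) = (r : ℂ) • WithLp.ofLp x := by
      ext i
      simp
    rw [this, eval_smul_of_isHomogeneous hP, ← ENNReal.ofReal_mul (by positivity), norm_mul,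
      norm_pow, Complex.norm_real, Real.norm_of_nonneg hr.le, mul_pow, ← pow_mul, mul_comm δ 2]
  · have : ContinuousOn (fun r : ℝ => w (r ^ 2)) (Set.Ioi 0) :=
      (continuousOn_norm_profile hκ hf).comp (continuous_pow 2).continuousOn
        fun r (hr : 0 < r) => pow_pos hr 2
    exact ENNReal.measurable_ofReal.comp this.domRestrict.measurable

theorem lintegral_calabiVolume_lt_top_iff (hn : 1 ≤ n) (hκ : 0 < κ) (hf : IsTwistFactor n κ ℓ f)
    (hP : P.IsHomogeneous δ) (hP0 : P ≠ 0) {ρ : LineBundleCompl n → ℝ≥0∞}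
    (hρ : ∀ z : {z : Fin (n + 1) → ℂ // z ≠ 0}, ρ (Quotient.mk (rootSetoid n) z) =
      ENNReal.ofReal (formNormSq (calabiMetric n κ) (zeroMode n κ δ f P) z)) :
    ∫⁻ x, ρ x ∂(calabiVolume n κ) < ⊤ ↔ (δ : ℤ) < ℓ := by
  have hU : MeasurableSet {z : Fin (n + 1) → ℂ | z ≠ 0} := isOpen_ne_zero.measurableSet
  have hmeas : Measurable ρ := by
    rw [measurable_from_quotient]
    have h1 : ContinuousOn (fun z : Fin (n + 1) → ℂ => ‖MvPolynomial.eval z P‖ ^ 2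
        * (f (sq z) ^ 2 / (calabiF n κ (sq z) ^ n * sq z ^ (2 * δ + 2 * n + 1))))
        {z | z ≠ 0} :=
      (((differentiable_eval P).continuous.norm).pow 2).continuousOn.mul
        ((continuousOn_norm_profile hκ hf).comp contDiff_sq.continuous.continuousOn
          fun z hz => sq_pos hz)
    have h2 : Measurable fun z : {z : Fin (n + 1) → ℂ // z ≠ 0} => ENNReal.ofReal
        (‖MvPolynomial.eval z.1 P‖ ^ 2 * (f (sq z.1) ^ 2
          / (calabiF n κ (sq z.1) ^ n * sq z.1 ^ (2 * δ + 2 * n + 1)))) :=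
      ENNReal.measurable_ofReal.comp h1.domRestrict.measurable
    convert h2 using 1
    funext z
    exact (hρ z).trans (congrArg ENNReal.ofReal (formNormSq_zeroMode hκ z.2))
  -- Since det g = 1 off the origin, the Riemannian volume is Lebesgue measure there.
  have hdens : (metricVolume (calabiMetric n κ)).restrict {z : Fin (n + 1) → ℂ | z ≠ 0}
      = volume.restrict {z : Fin (n + 1) → ℂ | z ≠ 0} := by
    rw [metricVolume, restrict_withDensity hU]
    conv_rhs => rw [← withDensity_one (μ := volume.restrict _)]
    refine withDensity_congr_ae (ae_restrict_of_forall_mem hU fun z hz => ?_)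
    simp [det_calabiMetric hκ hz]
  have hint : ∫⁻ x, ρ x ∂(calabiVolume n κ) = ((n : ℝ≥0∞) + 1)⁻¹ * (sphereIntegral P
      * ∫⁻ r in Set.Ioi (0 : ℝ), ENNReal.ofReal (radialProfile n κ δ f r)) := by
    rw [calabiVolume, lintegral_smul_measure, lintegral_map hmeas measurable_quotient_mk'', smul_eq_mul]
    simp only [hρ]
    rw [← setLIntegral_formNormSq_zeroMode hκ hf hP, ← hdens]
    congr 1
    exact lintegral_subtype_comap hU
      (fun z => ENNReal.ofReal (formNormSq (calabiMetric n κ) (zeroMode n κ δ f P) z))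
  have hn0 : ((n : ℝ≥0∞) + 1)⁻¹ ≠ 0 := by simp
  have hnt : ((n : ℝ≥0∞) + 1)⁻¹ ≠ ⊤ := by simp
  have hJ : ∫⁻ r in Set.Ioi (0 : ℝ), ENNReal.ofReal (radialProfile n κ δ f r) < ⊤
      ↔ IntegrableOn (radialProfile n κ δ f) (Set.Ioi 0) := by
    have hm := (continuousOn_radialProfile (δ := δ) hκ hf).aestronglyMeasurable
      (μ := volume) measurableSet_Ioi
    rw [IntegrableOn, Integrable, and_iff_right hm, hasFiniteIntegral_iff_ofReal]
    exact ae_restrict_of_forall_mem measurableSet_Ioi fun r hr => radialProfile_nonneg hκ hr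
  -- The covering factor and the sphere integral are finite and non-zero, so only the radial
  -- integral decides.
  rw [hint, ← integrableOn_radialProfile_iff hn hκ hf, ← hJ, lt_top_iff_ne_top, lt_top_iff_ne_top,
    not_iff_not, ENNReal.mul_eq_top, ENNReal.mul_eq_top]
  simp [hn0, hnt, sphereIntegral_ne_zero hP hP0, sphereIntegral_ne_top P]

end SquareIntegrable

end

end CalabiDirac

theorem mainTheorem2 (n : ℕ) (hn : 1 ≤ n) (κ : ℝ) (hκ : 0 < κ) (ℓ : ℤ) (δ : ℕ) :
    (∃ f : ℝ → ℝ, IsTwistFactor n κ ℓ f) ∧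
    ∀ f : ℝ → ℝ, IsTwistFactor n κ ℓ f →
    ∀ P : MvPolynomial (Fin (n + 1)) ℂ, P.IsHomogeneous δ →
      IsZeroMode (calabiMetric n κ) (calabiConnection n κ ℓ) {z | z ≠ 0}
        (zeroMode n κ δ f P) ∧
      ∃ ρ : LineBundleCompl n → ℝ≥0∞,
        (∀ z : {z : Fin (n + 1) → ℂ // z ≠ 0},
          ρ (Quotient.mk (rootSetoid n) z) =
            ENNReal.ofReal (formNormSq (calabiMetric n κ) (zeroMode n κ δ f P) z)) ∧
        (P ≠ 0 → ((∫⁻ x, ρ x ∂(calabiVolume n κ)) < ⊤ ↔ (δ : ℤ) < ℓ)) := by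
  refine ⟨exists_isTwistFactor n hκ ℓ, fun f hf P hP => ⟨isZeroMode_zeroMode hκ hf hP, ?_⟩⟩
  refine ⟨Quotient.lift (fun z : {z : Fin (n + 1) → ℂ // z ≠ 0} =>
    ENNReal.ofReal (formNormSq (calabiMetric n κ) (zeroMode n κ δ f P) z)) ?_,
    fun z => rfl, fun hP0 => lintegral_calabiVolume_lt_top_iff hn hκ hf hP hP0 fun z => rfl⟩
  -- A root of unity ε has modulus 1, and P(εz) = ε^δ P(z), so the norm is constant on classes.
  rintro z w ⟨ε, hε, h⟩
  simp only [h]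
  rw [formNormSq_zeroMode_smul hκ hP z.2 (Complex.norm_eq_one_of_pow_eq_one hε n.succ_ne_zero)]
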